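/- Sequences $d=d_1d_2\ldots\in\{0,1\}^{\mathbb N}$ and words are ordered lexicographically ($\prec,\preccurlyeq$), a bar denotes the reflection $0\leftrightarrow1$, $\sigma$ is the left shift, $w^\infty=www\ldots$, and $(d)_q:=\sum_{i\ge1}d_iq^{-i}$. For $x>0$ let $\mathscr U(x)$ be the set of $q\in(1,2]$ for which there is exactly one $d\in\{0,1\}^{\mathbb N}$ with $(d)_q=x$, let $q_s(x):=\inf\mathscr U(x)$, and let $\overline{\mathscr U}$ be the closure of $\mathscr U(1)$. For $q\in(1,2]$ let $\alpha(q)=\alpha_1(q)\alpha_2(q)\ldots$ be the quasi-greedy expansion of $1$ in base $q$, i.e. the lexicographically largest $d$ with $(d)_q=1$ that does not end with $0^\infty$. Let $$\mathscr V:=\{q\in(1,2]:\ \overline{\alpha(q)}\preccurlyeq\sigma^n(\alpha(q))\preccurlyeq\alpha(q)\ \text{ for all } n\ge0\}.$$ For $x\in(0,1)$ consider the following algorithm. Let $q_G=(1+\sqrt5)/2$ and let $k\ge1$ be the integer with $q_G^{-k}\le x<q_G^{-k+1}$. For $j=1,2,\ldots$, given the words $B_1,\ldots,B_{j-1}$,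 step $j$ is as follows. Let $q_j\in(1,2]$ be the base with $(0^{k-1}B_1\cdots B_{j-1}01^\infty)_{q_j}=x$. If $q_j\in\overline{\mathscr U}$, stop. Otherwise let $$n_j:=\min\{n\ge1:\ \overline{\alpha_n(q_j)\alpha_{n+1}(q_j)\ldots}\succcurlyeq\alpha(q_j)\},\qquad B_j:=1\,\overline{\alpha_1(q_j)\ldots\alpha_{n_j-2}(q_j)},$$ $$m_j:=\min\{m>n_j:\ \overline{\alpha_{n_j}(q_j)\ldots\alpha_m(q_j)}\succ\alpha_1(q_j)\ldots\alpha_{m-n_j+1}(q_j)\},$$ with $m_j:=\infty$ if no such $m$ exists, let $r_j\in(1,2]$ be the base with $(0^{k-1}B_1\cdots B_{j-1}B_j^\infty)_{r_j}=x$, and go to step $j+1$. The point $x$ is said to be of type II if the algorithm never stops and, for some $j$, $m_j<\infty$ and $\alpha_1(q_j)\ldots\alpha_{m_j}(q_j)=\alpha_1(r_j)\ldots\alpha_{m_j}(r_j)$. **Proposition.** Let $x\in(0,1)$. Then $x$ is of type II if and only if $q_s(x)\notin\mathscr V$. -/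

import Mathlib

namespace SmallestBase

/-!
An infinite sequence `d₁ d₂ d₃ …` of binary digits is a function `d : ℕ → Bool` with
`d i = dᵢ₊₁` (the digit `1` is `true`), and a word is a list of Booleans.
-/

/-- Strict lexicographic order on sequences. -/
def SeqLT (a b : ℕ → Bool) : Prop :=
  ∃ i, (∀ j < i, a j = b j) ∧ a i = false ∧ b i = true

/-- Lexicographic order on sequences. -/
def SeqLE (a b : ℕ → Bool) : Prop := SeqLT a b ∨ a = b

/-- The reflection of a sequence: every digit `c` becomes `1 - c`. -/
def conj (a : ℕ → Bool) : ℕ → Bool := fun i => !(a i)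

/-- The `n`-fold left shift `σⁿ`. -/
def shift (n : ℕ) (a : ℕ → Bool) : ℕ → Bool := fun i => a (i + n)

/-- The concatenation `w d` of a word and a sequence. -/
def prepend (w : List Bool) (d : ℕ → Bool) : ℕ → Bool :=
  fun i => if i < w.length then w.getD i false else d (i - w.length)

/-- The periodic sequence `w^∞ = w w w …` (for a nonempty word `w`). -/
def periodic (w : List Bool) : ℕ → Bool := fun i => w.getD (i % w.length) false

/-- Words are compared after padding both with `0^∞`. -/
def WordLT (v w : List Bool) : Prop :=
  SeqLT (prepend v fun _ => false) (prepend w fun _ => false)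

/-- The word `a_i a_{i+1} … a_j` with digits numbered from `1` (so `1 ≤ i`);
it is empty if `j < i`. -/
def segment (a : ℕ → Bool) (i j : ℕ) : List Bool :=
  (List.range (j + 1 - i)).map fun t => a (i - 1 + t)

/-- The number `(d)_q = ∑_{i ≥ 1} dᵢ / qⁱ`. -/
noncomputable def value (d : ℕ → Bool) (q : ℝ) : ℝ :=
  ∑' i : ℕ, (if d i then (1 : ℝ) else 0) / q ^ (i + 1)

/-- `univoqueBases x` is the set `𝒰(x)` of all bases `q ∈ (1, 2]` in which `x` has exactly one
expansion with digits `0` and `1`. -/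
def univoqueBases (x : ℝ) : Set ℝ :=
  {q | 1 < q ∧ q ≤ 2 ∧ ∃! d : ℕ → Bool, value d q = x}

/-- The smallest univoque base `q_s(x) = inf 𝒰(x)`. -/
noncomputable def qs (x : ℝ) : ℝ := sInf (univoqueBases x)

/-- The sequence does not end with `0^∞`. -/
def InfinitelyManyOnes (d : ℕ → Bool) : Prop := ∀ N, ∃ i, N ≤ i ∧ d i = true

/-- `d` is the quasi-greedy `q`-expansion of `x`: the lexicographically largest `q`-expansion
of `x` that does not end with `0^∞`. -/
def IsQuasiGreedy (q x : ℝ) (d : ℕ → Bool) : Prop :=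
  value d q = x ∧ InfinitelyManyOnes d ∧
    ∀ e : ℕ → Bool, value e q = x → InfinitelyManyOnes e → SeqLE e d

/-- `α(q)`, the quasi-greedy `q`-expansion of `1`, for `q ∈ (1, 2]` (where it exists and is
unique). -/
noncomputable def alpha (q : ℝ) : ℕ → Bool := Classical.epsilon (IsQuasiGreedy q 1)

/-- The set `𝒱` of de Vries and Komornik. -/
def setV : Set ℝ :=
  {q | 1 < q ∧ q ≤ 2 ∧
    ∀ n : ℕ, SeqLE (conj (alpha q)) (shift n (alpha q)) ∧ SeqLE (shift n (alpha q)) (alpha q)}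

/-- `q` is the base in `(1, 2]` with `(d)_q = x`. (It is unique if `d` contains a `1`, because
`q ↦ (d)_q` is then strictly decreasing.) -/
def IsBaseOf (x : ℝ) (d : ℕ → Bool) (q : ℝ) : Prop :=
  1 < q ∧ q ≤ 2 ∧ value d q = x

/-- The sequence `0 1^∞`. -/
def zeroOnes : ℕ → Bool := prepend [false] fun _ => true

/-- `n` is the least `n ≥ 1` such that the reflection of `α_n(q) α_{n+1}(q) …` is `≽ α(q)`. -/
def IsN (q : ℝ) (n : ℕ) : Prop :=
  IsLeast {n : ℕ | 1 ≤ n ∧ SeqLE (alpha q) (conj (shift (n - 1) (alpha q)))} n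

/-- `m` is the least `m > n` such that the reflection of `α_n(q) … α_m(q)` is
`≻ α_1(q) … α_{m-n+1}(q)`. If there is no such `m`, the algorithm sets `m = ∞`, and no natural
number satisfies this predicate. -/
def IsM (q : ℝ) (n m : ℕ) : Prop :=
  IsLeast {m : ℕ | n < m ∧
    WordLT (segment (alpha q) 1 (m - n + 1)) (segment (conj (alpha q)) n m)} m

/-- The block `1` followed by the reflection of `α_1(q) … α_{n-2}(q)`. -/
noncomputable def block (q : ℝ) (n : ℕ) : List Bool :=
  true :: segment (conj (alpha q)) 1 (n - 2)

/-- The word `0^(k-1) B₁ B₂ … B_j`, where `B i` stands for the block `B_{i+1}`. -/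
def blocks (k : ℕ) (B : ℕ → List Bool) (j : ℕ) : List Bool :=
  List.replicate (k - 1) false ++ ((List.range j).map B).flatten

/-- A run of the algorithm on `x` that never stops. The entries with index `j` are the data of
the step number `j + 1`: the lower bound `q_{j+1}`, the index `n_{j+1}`, the block `B_{j+1}`
and the upper bound `r_{j+1}`. The algorithm stops at a step exactly if the lower bound found
there lies in the closure of `𝒰 = 𝒰(1)`. The number `k` is the one with
`q_G^(-k) ≤ x < q_G^(-k+1)`; all expansions are preceded by `0^(k-1)`. All data are uniquely
determined by `x`. -/
structure IsInfiniteRun (x : ℝ) (k : ℕ) (q : ℕ → ℝ) (n : ℕ → ℕ) (B : ℕ → List Bool)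
    (r : ℕ → ℝ) : Prop where
  one_le : 1 ≤ k
  lower_x : Real.goldenRatio ^ (-(k : ℤ)) ≤ x
  x_upper : x < Real.goldenRatio ^ (-(k : ℤ) + 1)
  isBase_q : ∀ j, IsBaseOf x (prepend (blocks k B j) zeroOnes) (q j)
  not_stop : ∀ j, q j ∉ closure (univoqueBases 1)
  isN : ∀ j, IsN (q j) (n j)
  block_eq : ∀ j, B j = block (q j) (n j)
  isBase_r : ∀ j, IsBaseOf x (prepend (blocks k B j) (periodic (B j))) (r j)

/-- The finiteness condition at one step, with lower bound `q`, index `n` and upper bound `r`: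
`m < ∞` and `α_1(q) … α_m(q) = α_1(r) … α_m(r)`. -/
def FiniteCondition (q : ℝ) (n : ℕ) (r : ℝ) : Prop :=
  ∃ m : ℕ, IsM q n m ∧ segment (alpha q) 1 m = segment (alpha r) 1 m

/-- `x` is of type II: the algorithm never stops, and the finiteness condition holds at some
step. -/
def IsTypeII (x : ℝ) : Prop :=
  ∃ (k : ℕ) (q : ℕ → ℝ) (n : ℕ → ℕ) (B : ℕ → List Bool) (r : ℕ → ℝ),
    IsInfiniteRun x k q n B r ∧ ∃ j, FiniteCondition (q j) (n j) (r j)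

end SmallestBase

namespace SmallestBase

/-! The algorithm builds words `w_j = 0^(k-1) B_1 … B_(j-1)` and increasing lower bounds `q_j` of
`q_s(x)`. In base `q = q_j`, the sequence `0 1^∞` and `1` followed by the reflection of `α(q)` have
the same value, so `x` is also the value of `w_j` followed by the latter. Let `N = n_j - 1` be the
critical shift. In the latter sequence the digit after the block `B_j` is `0`, and the tail behind
this `0` is `≽ α(q)`, hence of value at least one. So `x` lies in the switch region after `w_j B_j`,
where the next digit may be `0` or `1`, and it stays there for all bases up to `q_(j+1)`; none of
them is univoque (`IsLowerBase.next`).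

If the algorithm never stops, `q_j` increases to a base `p` in which the concatenation of all blocks
represents `x`. Minimality of the critical shifts and monotonicity of `q ↦ α(q)` make this sequence
satisfy the lexicographic criterion for unique expansions (`BlockFamily.lexUnivoque`). Hence `p =
q_s(x)` (`IsInfiniteRun.exists_limit`).

Now `p ∉ 𝒱` means that some reflected tail of `α(p)` strictly exceeds `α(p)`, which a finite prefix
already shows. By left continuity of `α` the late lower bounds share this prefix, so the blocks
become constant, `r_j = p`, and the finiteness condition holds. Conversely, this condition freezes
the decisive prefix of `α` on all of `[q_j, r_j]`. Then `B_j` repeats forever, `p = r_j`, and `α(p)`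
violates the inequality defining `𝒱`.

Finally, `q_s(x) ∉ 𝒱` forces the run to be infinite. If all reflected tails of `α(q_J)` were
strictly smaller than `α(q_J)`, then `x` would have univoque bases arbitrarily close above `q_J`,
and `q_s(x) = q_J ∈ 𝒱` (`IsPartialRun.qs_mem_setV`). So an index `n_j` always exists, and its
existence excludes `q_j` from the closure of `𝒰` (`conj_shift_alpha_lt_of_mem_closure`). -/

/-! ### Lexicographic order, reflection and shifts -/

theorem seqLT_iff_toLex {a b : ℕ → Bool} : SeqLT a b ↔ toLex a < toLex b := by
  constructor
  · rintro ⟨i, h, ha, hb⟩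
    exact ⟨i, h, by simp [ha, hb]⟩
  · rintro ⟨i, h, hi⟩
    have := Bool.lt_iff.1 hi
    exact ⟨i, h, this.1, this.2⟩

theorem seqLE_iff_toLex {a b : ℕ → Bool} : SeqLE a b ↔ toLex a ≤ toLex b := by
  rw [SeqLE, seqLT_iff_toLex, ← toLex_inj]
  exact le_iff_lt_or_eq.symm

theorem SeqLE.refl (a : ℕ → Bool) : SeqLE a a := Or.inr rfl

theorem SeqLT.le {a b : ℕ → Bool} (h : SeqLT a b) : SeqLE a b := Or.inl h

theorem SeqLE.trans {a b c : ℕ → Bool} (h : SeqLE a b) (h' : SeqLE b c) : SeqLE a c := by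
  rw [seqLE_iff_toLex] at *; exact h.trans h'

theorem SeqLT.trans_le {a b c : ℕ → Bool} (h : SeqLT a b) (h' : SeqLE b c) : SeqLT a c := by
  rw [seqLT_iff_toLex] at *; rw [seqLE_iff_toLex] at h'; exact h.trans_le h'

theorem SeqLE.trans_lt {a b c : ℕ → Bool} (h : SeqLE a b) (h' : SeqLT b c) : SeqLT a c := by
  rw [seqLT_iff_toLex] at *; rw [seqLE_iff_toLex] at h; exact h.trans_lt h'

theorem SeqLE.antisymm {a b : ℕ → Bool} (h : SeqLE a b) (h' : SeqLE b a) : a = b := by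
  rw [seqLE_iff_toLex] at *
  exact toLex.injective (le_antisymm h h')

theorem not_seqLT {a b : ℕ → Bool} : ¬ SeqLT a b ↔ SeqLE b a := by
  rw [seqLT_iff_toLex, seqLE_iff_toLex]; exact not_lt

theorem not_seqLE {a b : ℕ → Bool} : ¬ SeqLE a b ↔ SeqLT b a := by
  rw [seqLT_iff_toLex, seqLE_iff_toLex]; exact not_le

theorem conj_conj (a : ℕ → Bool) : conj (conj a) = a := by
  funext i; simp [conj]

theorem conj_apply (a : ℕ → Bool) (i : ℕ) : conj a i = !(a i) := rfl

theorem shift_apply (a : ℕ → Bool) (n i : ℕ) : shift n a i = a (i + n) := rfl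

theorem shift_shift (m n : ℕ) (a : ℕ → Bool) : shift m (shift n a) = shift (m + n) a := by
  funext i; simp [shift, add_assoc]

theorem shift_zero (a : ℕ → Bool) : shift 0 a = a := rfl

theorem conj_shift (n : ℕ) (a : ℕ → Bool) : conj (shift n a) = shift n (conj a) := rfl

theorem SeqLT.conj {a b : ℕ → Bool} (h : SeqLT a b) :
    SeqLT (SmallestBase.conj b) (SmallestBase.conj a) := by
  obtain ⟨i, h, ha, hb⟩ := h
  exact ⟨i, fun j hj => by simp [conj_apply, h j hj], by simp [conj_apply, hb],
    by simp [conj_apply, ha]⟩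

theorem SeqLE.conj {a b : ℕ → Bool} (h : SeqLE a b) :
    SeqLE (SmallestBase.conj b) (SmallestBase.conj a) := by
  rcases h with h | rfl
  · exact h.conj.le
  · exact SeqLE.refl _

theorem seqLT_shift_iff {a b : ℕ → Bool} {n : ℕ} (h : ∀ j < n, a j = b j) :
    SeqLT (shift n a) (shift n b) ↔ SeqLT a b := by
  constructor
  · rintro ⟨i, hi, ha, hb⟩
    refine ⟨i + n, fun j hj => ?_, ha, hb⟩
    by_cases hjn : j < n
    · exact h j hjn
    · have := hi (j - n) (by omega)
      simpa [shift, Nat.sub_add_cancel (not_lt.1 hjn)] using this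
  · rintro ⟨i, hi, ha, hb⟩
    have hin : n ≤ i := by
      by_contra hlt
      have := h i (by omega)
      simp [ha, hb] at this
    refine ⟨i - n, fun j hj => hi _ (by omega), ?_, ?_⟩ <;>
      simpa [shift, Nat.sub_add_cancel hin]

theorem seqLE_shift_iff {a b : ℕ → Bool} {n : ℕ} (h : ∀ j < n, a j = b j) :
    SeqLE (shift n a) (shift n b) ↔ SeqLE a b := by
  rw [← not_seqLT, ← not_seqLT, seqLT_shift_iff fun j hj => (h j hj).symm]

theorem exists_first_ne {a b : ℕ → Bool} (h : a ≠ b) :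
    ∃ i, (∀ j < i, a j = b j) ∧ a i ≠ b i := by
  have h' : ∃ i, a i ≠ b i := by
    by_contra hc
    push Not at hc
    exact h (funext hc)
  classical
  exact ⟨Nat.find h', fun j hj => not_not.1 (Nat.find_min h' hj), Nat.find_spec h'⟩

/-- The first `N` digits of `a` form a word that is at most the word of the first `N` digits
of `b`. -/
def PrefixLE (N : ℕ) (a b : ℕ → Bool) : Prop :=
  ∀ i < N, (∀ j < i, a j = b j) → a i = true → b i = true

theorem SeqLE.prefixLE {a b : ℕ → Bool} (h : SeqLE a b) (N : ℕ) : PrefixLE N a b := by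
  intro i _ hj ha
  by_contra hb
  rw [Bool.not_eq_true] at hb
  exact not_seqLT.2 h ⟨i, fun j hj' => (hj j hj').symm, hb, ha⟩

theorem PrefixLE.mono {a b : ℕ → Bool} {M N : ℕ} (h : PrefixLE N a b) (hMN : M ≤ N) :
    PrefixLE M a b := fun i hi => h i (hi.trans_le hMN)

theorem PrefixLE.congr_left {a a' b : ℕ → Bool} {N : ℕ} (h : PrefixLE N a b)
    (ha : ∀ j < N, a' j = a j) : PrefixLE N a' b := by
  intro i hi hj h1
  rw [ha i hi] at h1
  exact h i hi (fun j hji => by rw [← ha j (hji.trans hi), hj j hji]) h1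

/-- A word comparison followed by a strict one within its range gives a strict comparison. -/
theorem PrefixLE.lt_of_lt {a b c : ℕ → Bool} {N i : ℕ} (h : PrefixLE N a b) (hi : i < N)
    (hbc : ∀ j < i, b j = c j) (hb : b i = false) (hc : c i = true) : SeqLT a c := by
  by_cases hab : ∀ j < i, a j = b j
  · refine ⟨i, fun j hj => (hab j hj).trans (hbc j hj), ?_, hc⟩
    by_contra ha
    rw [Bool.not_eq_false] at ha
    simp [h i hi hab ha] at hb
  · push Not at hab
    classical
    have hex : ∃ j, j < i ∧ a j ≠ b j := by simpa using hab
    obtain ⟨hj, hne⟩ := Nat.find_spec hex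
    have hmin : ∀ l < Nat.find hex, a l = b l := fun l hl => by
      by_contra hcon
      exact Nat.find_min hex hl ⟨hl.trans hj, hcon⟩
    have ha : a (Nat.find hex) = false := by
      by_contra ha
      rw [Bool.not_eq_false] at ha
      exact hne (ha.trans (h _ (hj.trans hi) hmin ha).symm)
    refine ⟨Nat.find hex, fun l hl => (hmin l hl).trans (hbc l (hl.trans hj)), ha, ?_⟩
    rw [← hbc _ hj]
    rw [ha] at hne
    simpa using hne.symm

theorem PrefixLE.trans {a b c : ℕ → Bool} {N : ℕ} (h : PrefixLE N a b) (h' : PrefixLE N b c) :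
    PrefixLE N a c := by
  intro i hi hac ha
  by_cases hab : ∀ j < i, a j = b j
  · exact h' i hi (fun j hj => by rw [← hab j hj, hac j hj]) (h i hi hab ha)
  · exfalso
    push Not at hab
    classical
    have hex : ∃ j, j < i ∧ a j ≠ b j := by simpa using hab
    obtain ⟨hj, hne⟩ := Nat.find_spec hex
    have hmin : ∀ l < Nat.find hex, a l = b l := fun l hl => by
      by_contra hcon
      exact Nat.find_min hex hl ⟨hl.trans hj, hcon⟩
    cases ha' : a (Nat.find hex) with
    | true => exact hne (ha'.trans (h _ (hj.trans hi) hmin ha').symm)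
    | false =>
      have hb : b (Nat.find hex) = true := by rw [ha'] at hne; simpa using hne.symm
      have := h' _ (hj.trans hi) (fun l hl => by rw [← hmin l hl, hac l (hl.trans hj)]) hb
      rw [← hac _ hj, ha'] at this
      simp at this

/-! ### Words in front of sequences -/

theorem prepend_lt {w : List Bool} {d : ℕ → Bool} {i : ℕ} (h : i < w.length) :
    prepend w d i = w.getD i false := by simp [prepend, h]

theorem prepend_add (w : List Bool) (d : ℕ → Bool) (i : ℕ) :
    prepend w d (w.length + i) = d i := by simp [prepend]

theorem shift_prepend (w : List Bool) (d : ℕ → Bool) : shift w.length (prepend w d) = d := by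
  funext i; simp [shift, prepend]

theorem prepend_nil (d : ℕ → Bool) : prepend [] d = d := by
  funext i; simp [prepend]

theorem prepend_append (v w : List Bool) (d : ℕ → Bool) :
    prepend (v ++ w) d = prepend v (prepend w d) := by
  funext i
  simp only [prepend, List.length_append]
  by_cases h : i < v.length
  · simp [h, Nat.lt_add_right]
  · have h' : (i < v.length + w.length) ↔ i - v.length < w.length := by omega
    simp only [h, if_false, h']
    by_cases h2 : i - v.length < w.length
    · rw [if_pos h2, if_pos h2, List.getD_append_right _ _ _ _ (not_lt.1 h)]
    · simp only [h2, if_false]; congr 1; omega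

theorem eq_prepend {w : List Bool} {d e : ℕ → Bool} (h1 : ∀ i < w.length, e i = w.getD i false)
    (h2 : shift w.length e = d) : e = prepend w d := by
  funext i
  by_cases h : i < w.length
  · rw [prepend_lt h, h1 i h]
  · obtain ⟨j, rfl⟩ := Nat.exists_eq_add_of_le (not_lt.1 h)
    rw [prepend_add, ← h2, shift, add_comm]

theorem prepend_periodic {w : List Bool} (hw : w ≠ []) :
    prepend w (periodic w) = periodic w := by
  have := List.length_pos_of_ne_nil hw
  refine (eq_prepend (fun i hi => ?_) ?_).symm
  · rw [periodic, Nat.mod_eq_of_lt hi]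
  · funext i; simp [shift, periodic]

theorem eq_periodic_of_prepend {w : List Bool} (hw : w ≠ []) {T : ℕ → ℕ → Bool}
    (h : ∀ i, T i = prepend w (T (i + 1))) (i : ℕ) : T i = periodic w := by
  have hl := List.length_pos_of_ne_nil hw
  funext m
  induction m using Nat.strong_induction_on generalizing i with
  | _ m ih =>
    rw [h i, ← prepend_periodic hw]
    by_cases hm : m < w.length
    · rw [prepend_lt hm, prepend_lt hm]
    · obtain ⟨j, rfl⟩ := Nat.exists_eq_add_of_le (not_lt.1 hm)
      rw [prepend_add, prepend_add, ih j (by omega)]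

/-! ### Values of sequences in a base -/

theorem digit_nonneg (b : Bool) : (0 : ℝ) ≤ if b then (1 : ℝ) else 0 := by split_ifs <;> norm_num

theorem digit_le_one (b : Bool) : (if b then (1 : ℝ) else 0) ≤ 1 := by split_ifs <;> norm_num

theorem hasSum_ones {q : ℝ} (hq : 1 < q) :
    HasSum (fun i : ℕ => (1 : ℝ) / q ^ (i + 1)) (1 / (q - 1)) := by
  have h := (hasSum_geometric_of_lt_one (inv_nonneg.2 (by linarith : 0 ≤ q))
    (inv_lt_one_of_one_lt₀ hq)).mul_left q⁻¹
  have h0 : q ≠ 0 := by positivity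
  have h1 : q - 1 ≠ 0 := by linarith
  have hf : (fun i : ℕ => (1 : ℝ) / q ^ (i + 1)) = fun i => q⁻¹ * q⁻¹ ^ i := by
    funext i
    rw [one_div, inv_pow, pow_succ, mul_inv, mul_comm]
  rw [hf, show 1 / (q - 1) = q⁻¹ * (1 - q⁻¹)⁻¹ by field_simp]
  exact h

theorem summable_value {q : ℝ} (hq : 1 < q) (d : ℕ → Bool) :
    Summable fun i : ℕ => (if d i then (1 : ℝ) else 0) / q ^ (i + 1) := by
  refine Summable.of_nonneg_of_le (fun i => ?_) (fun i => ?_) (hasSum_ones hq).summable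
  · exact div_nonneg (digit_nonneg _) (by positivity)
  · exact div_le_div_of_nonneg_right (digit_le_one _) (by positivity)

theorem value_nonneg {q : ℝ} (hq : 1 < q) (d : ℕ → Bool) : 0 ≤ value d q :=
  tsum_nonneg fun _ => div_nonneg (digit_nonneg _) (by positivity)

theorem value_conj {q : ℝ} (hq : 1 < q) (d : ℕ → Bool) :
    value (conj d) q = 1 / (q - 1) - value d q := by
  rw [eq_sub_iff_add_eq, value, value, ← (summable_value hq _).tsum_add (summable_value hq _),
    ← (hasSum_ones hq).tsum_eq]
  congr 1
  funext i
  cases h : d i <;> simp [conj, h]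

theorem value_le {q : ℝ} (hq : 1 < q) (d : ℕ → Bool) : value d q ≤ 1 / (q - 1) := by
  have := value_nonneg hq (conj d)
  rw [value_conj hq] at this
  linarith

theorem value_ones {q : ℝ} (hq : 1 < q) : value (fun _ => true) q = 1 / (q - 1) := by
  simpa [value] using (hasSum_ones hq).tsum_eq

theorem value_zeros (q : ℝ) : value (fun _ => false) q = 0 := by
  simp [value]

theorem value_succ {q : ℝ} (hq : 1 < q) (d : ℕ → Bool) :
    value d q = ((if d 0 then 1 else 0) + value (shift 1 d) q) / q := by
  have h0 : q ≠ 0 := by positivity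
  rw [value, (summable_value hq d).tsum_eq_zero_add, value, add_div, ← tsum_div_const]
  congr 1
  · simp
  · congr 1; funext i
    rw [shift, pow_succ q (i + 1), div_mul_eq_div_div]

theorem value_shift {q : ℝ} (hq : 1 < q) (d : ℕ → Bool) (n : ℕ) :
    value (shift n d) q = ((if d n then 1 else 0) + value (shift (n + 1) d) q) / q := by
  rw [value_succ hq, shift_shift, shift_apply, zero_add, add_comm 1 n]

/-- If `d` and `e` agree on their first `n` digits, then their values differ by `q ^ (-n)` times
the difference of the values of the tails. -/
theorem value_sub_value {q : ℝ} (hq : 1 < q) {d e : ℕ → Bool} {n : ℕ}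
    (h : ∀ j < n, d j = e j) :
    value d q - value e q = (value (shift n d) q - value (shift n e) q) / q ^ n := by
  induction n with
  | zero => simp [shift_zero]
  | succ n ih =>
    have h0 : q ≠ 0 := by positivity
    rw [ih fun j hj => h j (by omega), value_shift hq d n, value_shift hq e n, h n (by omega)]
    rw [← sub_div, div_div, pow_succ, mul_comm q]
    congr 1
    ring

theorem value_sub_of_first {q : ℝ} (hq : 1 < q) {a b : ℕ → Bool} {i : ℕ}
    (h : ∀ j < i, a j = b j) (ha : a i = false) (hb : b i = true) :
    value b q - value a q =
      (1 + value (shift (i + 1) b) q - value (shift (i + 1) a) q) / q ^ (i + 1) := by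
  have h0 : q ≠ 0 := by positivity
  rw [value_sub_value hq fun j hj => (h j hj).symm, value_shift hq b, value_shift hq a, ha, hb]
  simp only [if_true, Bool.false_eq_true, if_false]
  rw [← sub_div, div_div, pow_succ, mul_comm q]
  congr 1
  ring

/-- The value of the word `w`, as the value of `w 0^∞`. -/
noncomputable def wordValue (w : List Bool) (q : ℝ) : ℝ := value (prepend w fun _ => false) q

theorem value_prepend {q : ℝ} (hq : 1 < q) (w : List Bool) (d : ℕ → Bool) :
    value (prepend w d) q = wordValue w q + value d q / q ^ w.length := by
  have h := value_sub_value hq (d := prepend w d) (e := prepend w fun _ => false) (n := w.length)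
    (fun j hj => by rw [prepend_lt hj, prepend_lt hj])
  rw [shift_prepend, shift_prepend, value_zeros, sub_zero] at h
  rw [wordValue]; linarith

theorem value_anti {p q : ℝ} (hp : 1 < p) (hpq : p ≤ q) (d : ℕ → Bool) :
    value d q ≤ value d p := by
  refine (summable_value (hp.trans_le hpq) d).tsum_le_tsum (fun i => ?_) (summable_value hp d)
  exact div_le_div_of_nonneg_left (digit_nonneg _) (by positivity)
    (pow_le_pow_left₀ (by linarith) hpq _)

theorem value_strictAnti {p q : ℝ} (hp : 1 < p) (hpq : p < q) {d : ℕ → Bool} {i : ℕ}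
    (hi : d i = true) : value d q < value d p := by
  refine Summable.tsum_lt_tsum (i := i) (fun j => ?_) ?_ (summable_value (hp.trans hpq) d)
    (summable_value hp d)
  · exact div_le_div_of_nonneg_left (digit_nonneg _) (by positivity)
      (pow_le_pow_left₀ (by linarith) hpq.le _)
  · simp only [hi, if_true]
    exact div_lt_div_of_pos_left one_pos (by positivity)
      (pow_lt_pow_left₀ hpq (by linarith) (by omega))

theorem value_pos {q : ℝ} (hq : 1 < q) {d : ℕ → Bool} {i : ℕ} (hi : d i = true) :
    0 < value d q := by
  refine (summable_value hq d).tsum_pos (fun j => div_nonneg (digit_nonneg _) (by positivity)) i ?_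
  simp only [hi, if_true]
  positivity

theorem exists_eq_true_of_value_pos {q : ℝ} {d : ℕ → Bool} (h : 0 < value d q) :
    ∃ i, d i = true := by
  by_contra hc
  push Not at hc
  have : d = fun _ => false := funext fun i => by simpa using hc i
  rw [this, value_zeros] at h
  exact lt_irrefl _ h

theorem continuousOn_value (d : ℕ → Bool) : ContinuousOn (value d) (Set.Ioi 1) := by
  intro q hq
  rw [Set.mem_Ioi] at hq
  obtain ⟨a, ha, haq⟩ := exists_between hq
  have h : ContinuousOn (value d) (Set.Ici a) := by
    refine continuousOn_tsum (u := fun i : ℕ => (1 : ℝ) / a ^ (i + 1)) (fun i => ?_)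
      (hasSum_ones ha).summable (fun i p hp => ?_)
    · refine continuousOn_const.div (by fun_prop) fun p hp => ?_
      have : a ≤ p := hp
      have : 0 < p := by linarith
      positivity
    · have hp : a ≤ p := hp
      have : 0 < p := by linarith
      rw [Real.norm_of_nonneg (div_nonneg (digit_nonneg _) (by positivity))]
      exact div_le_div₀ zero_le_one (digit_le_one _) (by positivity)
        (pow_le_pow_left₀ (by linarith) hp _)
  exact (h.continuousAt (Ici_mem_nhds haq)).continuousWithinAt

theorem continuousAt_value {q : ℝ} (hq : 1 < q) (d : ℕ → Bool) : ContinuousAt (value d) q :=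
  (continuousOn_value d).continuousAt (Ioi_mem_nhds hq)

theorem abs_value_sub_le {q : ℝ} (hq : 1 < q) {d e : ℕ → Bool} {n : ℕ}
    (h : ∀ j < n, d j = e j) : |value d q - value e q| ≤ 1 / (q - 1) / q ^ n := by
  rw [value_sub_value hq h, abs_div, abs_of_pos (by positivity : 0 < q ^ n)]
  refine div_le_div_of_nonneg_right ?_ (by positivity)
  rw [abs_le]
  constructor <;> linarith [value_nonneg hq (shift n d), value_le hq (shift n d),
    value_nonneg hq (shift n e), value_le hq (shift n e)]

theorem value_zeroOnes {q : ℝ} (hq : 1 < q) : value zeroOnes q = 1 / (q - 1) / q := by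
  rw [value_succ hq]
  have : shift 1 zeroOnes = fun _ => true := shift_prepend [false] _
  rw [this, value_ones hq]
  simp [zeroOnes, prepend]

theorem value_cons {q : ℝ} (hq : 1 < q) (b : Bool) (d : ℕ → Bool) :
    value (prepend [b] d) q = ((if b then 1 else 0) + value d q) / q := by
  rw [value_succ hq]
  have : shift 1 (prepend [b] d) = d := shift_prepend [b] _
  rw [this]
  simp [prepend]

/-! ### The quasi-greedy algorithm -/

/-- The remainders of the quasi-greedy algorithm for `y` in base `q`. -/
noncomputable def qgRem (q y : ℝ) : ℕ → ℝ
  | 0 => y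
  | n + 1 => if 1 < q * qgRem q y n then q * qgRem q y n - 1 else q * qgRem q y n

open Classical in
/-- The digits of the quasi-greedy algorithm for `y` in base `q`. -/
noncomputable def qgDigits (q y : ℝ) (n : ℕ) : Bool := decide (1 < q * qgRem q y n)

theorem qgRem_succ (q y : ℝ) (n : ℕ) :
    qgRem q y (n + 1) = q * qgRem q y n - if qgDigits q y n then 1 else 0 := by
  rw [qgRem]
  by_cases h : 1 < q * qgRem q y n <;> simp [qgDigits, h]

theorem qgRem_mem {q y : ℝ} (hq : 1 < q) (hq2 : q ≤ 2) (hy : 0 ≤ y) (hy1 : y ≤ 1 / (q - 1))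
    (n : ℕ) : 0 ≤ qgRem q y n ∧ qgRem q y n ≤ 1 / (q - 1) := by
  have hq1 : 0 < q - 1 := by linarith
  induction n with
  | zero => exact ⟨hy, hy1⟩
  | succ n ih =>
    rw [qgRem]
    split_ifs with h
    · refine ⟨by linarith, ?_⟩
      have := mul_le_mul_of_nonneg_left ih.2 (by linarith : 0 ≤ q)
      have h2 : q * (1 / (q - 1)) = 1 / (q - 1) + 1 := by field_simp; ring
      linarith
    · refine ⟨mul_nonneg (by linarith) ih.1, ?_⟩
      have : 1 ≤ 1 / (q - 1) := by rw [le_div_iff₀ hq1]; linarith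
      linarith

theorem qgRem_shift (q y : ℝ) (n i : ℕ) : qgRem q (qgRem q y n) i = qgRem q y (i + n) := by
  induction i with
  | zero => simp [qgRem]
  | succ i ih => rw [qgRem, ih, Nat.add_right_comm, qgRem]

theorem shift_qgDigits (q y : ℝ) (n : ℕ) : shift n (qgDigits q y) = qgDigits q (qgRem q y n) := by
  funext i; simp [shift, qgDigits, qgRem_shift]

theorem value_qgDigits {q y : ℝ} (hq : 1 < q) (hq2 : q ≤ 2) (hy : 0 ≤ y)
    (hy1 : y ≤ 1 / (q - 1)) : value (qgDigits q y) q = y := by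
  have h0 : 0 < q := by linarith
  have hpart : ∀ n, ∑ i ∈ Finset.range n, (if qgDigits q y i then (1 : ℝ) else 0) / q ^ (i + 1)
      = y - qgRem q y n / q ^ n := by
    intro n
    induction n with
    | zero => simp [qgRem]
    | succ n ih =>
      rw [Finset.sum_range_succ, ih, qgRem_succ]
      field_simp
      ring
  have h1 := (summable_value hq (qgDigits q y)).hasSum.tendsto_sum_nat
  have h2 : Filter.Tendsto (fun n => y - qgRem q y n / q ^ n) Filter.atTop (nhds (y - 0)) := by
    refine tendsto_const_nhds.sub ?_
    have h3 : Filter.Tendsto (fun n : ℕ => 1 / (q - 1) / q ^ n) Filter.atTop (nhds 0) := by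
      simpa using (tendsto_pow_atTop_atTop_of_one_lt hq).const_div_atTop (1 / (q - 1))
    refine squeeze_zero (fun n => div_nonneg (qgRem_mem hq hq2 hy hy1 n).1 (by positivity))
      (fun n => div_le_div_of_nonneg_right (qgRem_mem hq hq2 hy hy1 n).2 (by positivity)) h3
  rw [sub_zero] at h2
  simp_rw [hpart] at h1
  exact tendsto_nhds_unique h1 h2

/-- A digit `1` is taken only if something strictly positive remains. This is what distinguishes the
quasi-greedy from the greedy algorithm. -/
theorem qgRem_pos {q y : ℝ} (hq : 1 < q) (hy : 0 < y) (n : ℕ) : 0 < qgRem q y n := by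
  induction n with
  | zero => exact hy
  | succ n ih =>
    rw [qgRem]
    split_ifs with h
    · linarith
    · positivity

theorem infinitelyManyOnes_qgDigits {q y : ℝ} (hq : 1 < q) (hq2 : q ≤ 2) (hy : 0 < y)
    (hy1 : y ≤ 1 / (q - 1)) : InfinitelyManyOnes (qgDigits q y) := by
  intro N
  have hm := qgRem_mem hq hq2 hy.le hy1 N
  have hv := value_qgDigits hq hq2 hm.1 hm.2
  obtain ⟨i, hi⟩ := exists_eq_true_of_value_pos (hv.symm ▸ qgRem_pos hq hy N)
  rw [← shift_qgDigits] at hi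
  exact ⟨i + N, by omega, hi⟩

/-- A larger expansion would have a `1` at some place where the algorithm chose `0`. There the
remainder is at most one, while the digit `1` and a tail with further ones amount to more. -/
theorem isQuasiGreedy_qgDigits {q y : ℝ} (hq : 1 < q) (hq2 : q ≤ 2) (hy : 0 < y)
    (hy1 : y ≤ 1 / (q - 1)) : IsQuasiGreedy q y (qgDigits q y) := by
  refine ⟨value_qgDigits hq hq2 hy.le hy1, infinitelyManyOnes_qgDigits hq hq2 hy hy1, ?_⟩
  intro e he hinf
  rw [← not_seqLT]
  rintro ⟨i, hj, ha, hb⟩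
  have h := value_sub_of_first hq hj ha hb
  rw [he, value_qgDigits hq hq2 hy.le hy1, sub_self, shift_qgDigits] at h
  have hm := qgRem_mem hq hq2 hy.le hy1 (i + 1)
  rw [value_qgDigits hq hq2 hm.1 hm.2] at h
  obtain ⟨l, hl, hel⟩ := hinf (i + 1)
  have hpos : 0 < value (shift (i + 1) e) q :=
    value_pos hq (i := l - (i + 1)) (by rw [shift, Nat.sub_add_cancel hl, hel])
  have hle : qgRem q y (i + 1) ≤ 1 := by
    rw [qgRem_succ, ha]
    have : ¬ 1 < q * qgRem q y i := by simpa [qgDigits] using ha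
    simp; linarith
  have : 0 < (1 + value (shift (i + 1) e) q - qgRem q y (i + 1)) / q ^ (i + 1) :=
    div_pos (by linarith) (by positivity)
  linarith

theorem exists_value_eq {q y : ℝ} (hq : 1 < q) (hq2 : q ≤ 2) (hy : 0 ≤ y)
    (hy1 : y ≤ 1 / (q - 1)) : ∃ d, value d q = y :=
  ⟨_, value_qgDigits hq hq2 hy hy1⟩

/-! ### The quasi-greedy expansion of one -/

theorem one_le_one_div {q : ℝ} (hq : 1 < q) (hq2 : q ≤ 2) : 1 ≤ 1 / (q - 1) := by
  rw [le_div_iff₀ (by linarith)]; linarith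

theorem alpha_eq {q : ℝ} (hq : 1 < q) (hq2 : q ≤ 2) : alpha q = qgDigits q 1 := by
  have h1 := isQuasiGreedy_qgDigits hq hq2 one_pos (one_le_one_div hq hq2)
  have h2 : IsQuasiGreedy q 1 (alpha q) := Classical.epsilon_spec ⟨_, h1⟩
  exact SeqLE.antisymm (h1.2.2 _ h2.1 h2.2.1) (h2.2.2 _ h1.1 h1.2.1)

theorem value_alpha {q : ℝ} (hq : 1 < q) (hq2 : q ≤ 2) : value (alpha q) q = 1 := by
  rw [alpha_eq hq hq2]
  exact value_qgDigits hq hq2 zero_le_one (one_le_one_div hq hq2)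

theorem infinitelyManyOnes_alpha {q : ℝ} (hq : 1 < q) (hq2 : q ≤ 2) :
    InfinitelyManyOnes (alpha q) := by
  rw [alpha_eq hq hq2]
  exact infinitelyManyOnes_qgDigits hq hq2 one_pos (one_le_one_div hq hq2)

theorem InfinitelyManyOnes.value_shift_pos {d : ℕ → Bool} (hd : InfinitelyManyOnes d) {q : ℝ}
    (hq : 1 < q) (n : ℕ) : 0 < value (shift n d) q := by
  obtain ⟨l, hl, hel⟩ := hd n
  exact value_pos hq (i := l - n) (by rw [shift, Nat.sub_add_cancel hl, hel])

theorem qgRem_one_le {q : ℝ} (hq : 1 < q) (hq2 : q ≤ 2) (n : ℕ) : qgRem q 1 n ≤ 1 := by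
  induction n with
  | zero => exact le_rfl
  | succ n ih =>
    rw [qgRem]
    split_ifs with h
    · nlinarith
    · linarith

theorem value_shift_alpha_le {q : ℝ} (hq : 1 < q) (hq2 : q ≤ 2) (n : ℕ) :
    value (shift n (alpha q)) q ≤ 1 := by
  rw [alpha_eq hq hq2, shift_qgDigits]
  have hm := qgRem_mem hq hq2 zero_le_one (one_le_one_div hq hq2) n
  rw [value_qgDigits hq hq2 hm.1 hm.2]
  exact qgRem_one_le hq hq2 n

/-- A sequence that exceeds `α(q)` lexicographically has value at least one. -/
theorem one_le_value_of_alpha_le {q : ℝ} (hq : 1 < q) (hq2 : q ≤ 2) {e : ℕ → Bool}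
    (h : SeqLE (alpha q) e) : 1 ≤ value e q := by
  rcases h with ⟨i, hj, ha, hb⟩ | rfl
  · have h := value_sub_of_first hq hj ha hb
    rw [value_alpha hq hq2] at h
    have : 0 ≤ (1 + value (shift (i + 1) e) q - value (shift (i + 1) (alpha q)) q) / q ^ (i + 1) :=
      div_nonneg (by linarith [value_nonneg hq (shift (i + 1) e),
        value_shift_alpha_le hq hq2 (i + 1)]) (by positivity)
    linarith
  · exact (value_alpha hq hq2).ge

theorem lt_alpha_of_value_lt {q : ℝ} (hq : 1 < q) (hq2 : q ≤ 2) {e : ℕ → Bool}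
    (h : value e q < 1) : SeqLT e (alpha q) := by
  rw [← not_seqLE]
  exact fun hle => not_lt.2 (one_le_value_of_alpha_le hq hq2 hle) h

theorem shift_alpha_le {q : ℝ} (hq : 1 < q) (hq2 : q ≤ 2) (n : ℕ) :
    SeqLE (shift n (alpha q)) (alpha q) := by
  rw [← not_seqLT]
  rintro ⟨i, hj, ha, hb⟩
  have h := value_sub_of_first hq hj ha hb
  rw [value_alpha hq hq2, shift_shift] at h
  have : 0 < (1 + value (shift (i + 1 + n) (alpha q)) q
      - value (shift (i + 1) (alpha q)) q) / q ^ (i + 1) :=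
    div_pos (by linarith [(infinitelyManyOnes_alpha hq hq2).value_shift_pos hq (i + 1 + n),
      value_shift_alpha_le hq hq2 (i + 1)]) (by positivity)
  linarith [value_shift_alpha_le hq hq2 n]

/-- In the larger base the sequence `α(p)` has value less than one. -/
theorem alpha_lt_alpha {p q : ℝ} (hp : 1 < p) (hpq : p < q) (hq2 : q ≤ 2) :
    SeqLT (alpha p) (alpha q) := by
  have hp2 := hpq.le.trans hq2
  obtain ⟨i, -, hi⟩ := infinitelyManyOnes_alpha hp hp2 0
  refine lt_alpha_of_value_lt (hp.trans hpq) hq2 ?_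
  rw [← value_alpha hp hp2]
  exact value_strictAnti hp hpq hi

theorem alpha_le_alpha {p q : ℝ} (hp : 1 < p) (hpq : p ≤ q) (hq2 : q ≤ 2) :
    SeqLE (alpha p) (alpha q) := by
  rcases hpq.lt_or_eq with h | rfl
  · exact (alpha_lt_alpha hp h hq2).le
  · exact SeqLE.refl _

theorem alpha_zero {q : ℝ} (hq : 1 < q) (hq2 : q ≤ 2) : alpha q 0 = true := by
  rw [alpha_eq hq hq2]; simp [qgDigits, qgRem, hq]

theorem alpha_one {q : ℝ} (hq : Real.goldenRatio < q) (hq2 : q ≤ 2) : alpha q 1 = true := by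
  have h1 := Real.one_lt_goldenRatio
  have h2 := Real.goldenRatio_sq
  rw [alpha_eq (by linarith) hq2]
  have : 1 < q := by linarith
  simp only [qgDigits, qgRem, mul_one, this, if_true, decide_eq_true_eq]
  nlinarith

/-- The base `2` version of the monotonicity of the value. -/
theorem value_two_mono {a b : ℕ → Bool} (h : SeqLE a b) : value a 2 ≤ value b 2 := by
  rcases h with ⟨i, hj, ha, hb⟩ | rfl
  · have h := value_sub_of_first one_lt_two hj ha hb
    have h1 := value_le one_lt_two (shift (i + 1) a)
    have h2 := value_nonneg one_lt_two (shift (i + 1) b)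
    have : (0 : ℝ) ≤ (1 + value (shift (i + 1) b) 2 - value (shift (i + 1) a) 2) / 2 ^ (i + 1) :=
      div_nonneg (by norm_num at h1; linarith) (by positivity)
    linarith
  · exact le_rfl

/-- Sequences that are at most `α(q)` and stay so after each digit `0` have value at most one. -/
theorem value_le_one {q : ℝ} (hq : 1 < q) (hq2 : q ≤ 2) {e : ℕ → Bool}
    (he : SeqLE e (alpha q)) (h : ∀ n, e n = false → SeqLE (shift (n + 1) e) (alpha q)) :
    value e q ≤ 1 := by
  have hC := one_le_one_div hq hq2
  -- Each passage to the tail after the first difference, where `e` has the digit `0`, gains a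
  -- factor of at least `q`. After `K` passages the crude bound `1 / (q - 1)` leaves an error of at
  -- most `1 / (q - 1) / q ^ K`.
  have key : ∀ K : ℕ, ∀ e : ℕ → Bool, SeqLE e (alpha q) →
      (∀ n, e n = false → SeqLE (shift (n + 1) e) (alpha q)) →
      value e q ≤ 1 + 1 / (q - 1) / q ^ K := by
    intro K
    induction K with
    | zero =>
      intro e _ _
      have := value_le hq e
      simp only [pow_zero, div_one]
      linarith
    | succ K ih =>
      intro e he h
      rcases he with ⟨i, hj, ha, hb⟩ | rfl
      · have h1 := value_sub_of_first hq hj ha hb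
        have h2 := ih (shift (i + 1) e) (h i ha) (fun n hn => by
          rw [shift_shift]
          have := h (n + (i + 1)) hn
          rwa [show n + 1 + (i + 1) = n + (i + 1) + 1 by omega])
        have h3 := value_nonneg hq (shift (i + 1) (alpha q))
        rw [value_alpha hq hq2] at h1
        have h4 : -(1 / (q - 1) / q ^ K / q ^ (i + 1)) ≤ 1 - value e q := by
          rw [h1, ← neg_div]
          exact div_le_div_of_nonneg_right (by linarith) (by positivity)
        have h5 : 1 / (q - 1) / q ^ K / q ^ (i + 1) ≤ 1 / (q - 1) / q ^ (K + 1) := by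
          rw [pow_succ q K, ← div_div]
          refine div_le_div_of_nonneg_left (by positivity) (by positivity) ?_
          exact le_self_pow₀ hq.le (by omega)
        linarith
      · rw [value_alpha hq hq2]
        have : 0 ≤ 1 / (q - 1) / q ^ (K + 1) := by positivity
        linarith
  have h3 : Filter.Tendsto (fun n : ℕ => 1 + 1 / (q - 1) / q ^ n) Filter.atTop (nhds (1 + 0)) := by
    refine tendsto_const_nhds.add ?_
    simpa using (tendsto_pow_atTop_atTop_of_one_lt hq).const_div_atTop (1 / (q - 1))
  rw [add_zero] at h3
  exact ge_of_tendsto' h3 fun K => key K e he h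

theorem value_lt_one {q : ℝ} (hq : 1 < q) (hq2 : q ≤ 2) {e : ℕ → Bool}
    (he : SeqLT e (alpha q)) (h : ∀ n, e n = false → SeqLE (shift (n + 1) e) (alpha q)) :
    value e q < 1 := by
  obtain ⟨i, hj, ha, hb⟩ := he
  have h1 := value_sub_of_first hq hj ha hb
  have h2 := value_le_one hq hq2 (h i ha) (fun n hn => by
    rw [shift_shift]
    have := h (n + (i + 1)) hn
    rwa [show n + 1 + (i + 1) = n + (i + 1) + 1 by omega])
  rw [value_alpha hq hq2] at h1
  have h3 : 0 < (1 + value (shift (i + 1) (alpha q)) q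
      - value (shift (i + 1) e) q) / q ^ (i + 1) :=
    div_pos (by linarith [(infinitelyManyOnes_alpha hq hq2).value_shift_pos hq (i + 1)])
      (by positivity)
  linarith

/-- Left continuity of `q ↦ α(q)`. -/
theorem exists_lt_alpha_agree {q : ℝ} (hq : 1 < q) (hq2 : q ≤ 2) (L : ℕ) :
    ∃ p, 1 < p ∧ p < q ∧ ∀ s, p < s → s ≤ q → ∀ j < L, alpha s j = alpha q j := by
  obtain ⟨l, hl, hal⟩ := infinitelyManyOnes_alpha hq hq2 L
  -- The truncation of `α(q)` has value less than one at `q`, hence also at nearby `s`. So `u ≺ α(s)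
  -- ≼ α(q)` for such `s ≤ q`, which forces agreement on the first `L` digits.
  set u : ℕ → Bool := fun i => if i < L then alpha q i else false with hu
  have hlt : value u q < 1 := by
    have h1 := value_sub_value hq (d := alpha q) (e := u) (n := L) (fun j hj => by simp [hu, hj])
    have h2 : shift L u = fun _ => false := by funext i; simp [hu, shift]
    rw [h2, value_zeros, sub_zero, value_alpha hq hq2] at h1
    have h3 : 0 < value (shift L (alpha q)) q / q ^ L :=
      div_pos ((infinitelyManyOnes_alpha hq hq2).value_shift_pos hq L) (by positivity)
    linarith
  have hev : ∀ᶠ s in nhds q, value u s < 1 ∧ 1 < s :=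
    ((continuousAt_value hq u).eventually_lt continuousAt_const hlt).and (lt_mem_nhds hq)
  obtain ⟨a, b, ⟨haq, hqb⟩, hab⟩ := mem_nhds_iff_exists_Ioo_subset.1 hev
  refine ⟨max a ((1 + q) / 2), lt_max_of_lt_right (by linarith), max_lt haq (by linarith), ?_⟩
  intro s hs hsq
  obtain ⟨hs1, hs2⟩ := hab ⟨(le_max_left _ _).trans_lt hs, hsq.trans_lt hqb⟩
  have h1 := lt_alpha_of_value_lt hs2 (hsq.trans hq2) hs1
  have h2 := alpha_le_alpha hs2 hsq hq2
  by_contra hne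
  push Not at hne
  classical
  have hex : ∃ j, j < L ∧ alpha s j ≠ alpha q j := hne
  obtain ⟨hj, hnej⟩ := Nat.find_spec hex
  have hmin : ∀ l < Nat.find hex, alpha s l = alpha q l := fun l hl => by
    by_contra hcon
    exact Nat.find_min hex hl ⟨hl.trans hj, hcon⟩
  generalize Nat.find hex = j at *
  cases hs0 : alpha s j with
  | true => exact hnej (hs0.trans ((h2.prefixLE L) j hj hmin hs0).symm)
  | false =>
    have hq0 : alpha q j = true := by rw [hs0] at hnej; simpa using hnej.symm
    refine not_seqLT.2 h1.le ⟨j, fun l hl => ?_, hs0, by simp [hu, hj, hq0]⟩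
    simp [hu, hl.trans hj, hmin l hl]

/-! ### Unique expansions and the switch region -/

/-- The lexicographic characterization of the unique expansions in a base with `A = α(q)`. -/
def LexUnivoque (A d : ℕ → Bool) : Prop :=
  ∀ m, (d m = false → SeqLT (shift (m + 1) d) A) ∧
    (d m = true → SeqLT (conj (shift (m + 1) d)) A)

theorem LexUnivoque.mono {A A' d : ℕ → Bool} (h : LexUnivoque A d) (hA : SeqLE A A') :
    LexUnivoque A' d :=
  fun m => ⟨fun hm => ((h m).1 hm).trans_le hA, fun hm => ((h m).2 hm).trans_le hA⟩

theorem LexUnivoque.value_lt_one {q : ℝ} (hq : 1 < q) (hq2 : q ≤ 2) {d : ℕ → Bool}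
    (h : LexUnivoque (alpha q) d) {m : ℕ} (hm : d m = false) : value (shift (m + 1) d) q < 1 := by
  refine SmallestBase.value_lt_one hq hq2 ((h m).1 hm) fun n hn => ?_
  rw [shift_shift]
  have := ((h (n + (m + 1))).1 hn).le
  rwa [show n + 1 + (m + 1) = n + (m + 1) + 1 by omega]

theorem LexUnivoque.value_conj_lt_one {q : ℝ} (hq : 1 < q) (hq2 : q ≤ 2) {d : ℕ → Bool}
    (h : LexUnivoque (alpha q) d) {m : ℕ} (hm : d m = true) :
    value (conj (shift (m + 1) d)) q < 1 := by
  refine SmallestBase.value_lt_one hq hq2 ((h m).2 hm) fun n hn => ?_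
  rw [← conj_shift, shift_shift]
  have := ((h (n + (m + 1))).2 (by simpa [conj, shift] using hn)).le
  rwa [show n + 1 + (m + 1) = n + (m + 1) + 1 by omega]

/-- At the first difference with another expansion, the tail of `d` (or its reflection) has value
less than one, so the other tail cannot make up for the changed digit. -/
theorem LexUnivoque.mem_univoqueBases {q x : ℝ} (hq : 1 < q) (hq2 : q ≤ 2) {d : ℕ → Bool}
    (h : LexUnivoque (alpha q) d) (hd : value d q = x) : q ∈ univoqueBases x := by
  refine ⟨hq, hq2, d, hd, fun e he => ?_⟩
  by_contra hne
  obtain ⟨i, hj, hi⟩ := exists_first_ne hne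
  cases hdi : d i with
  | false =>
    have hei : e i = true := by rw [hdi] at hi; simpa using hi
    have h1 := value_sub_of_first hq (fun j hji => (hj j hji).symm) hdi hei
    have h2 := h.value_lt_one hq hq2 hdi
    have h3 := value_nonneg hq (shift (i + 1) e)
    have h4 : 0 < (1 + value (shift (i + 1) e) q - value (shift (i + 1) d) q) / q ^ (i + 1) :=
      div_pos (by linarith) (by positivity)
    have he' : value e q = x := he
    linarith
  | true =>
    have hei : e i = false := by rw [hdi] at hi; simpa using hi
    have h1 := value_sub_of_first hq hj hei hdi
    have h2 := h.value_conj_lt_one hq hq2 hdi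
    rw [value_conj hq] at h2
    have h3 := value_le hq (shift (i + 1) e)
    have h4 : 0 < (1 + value (shift (i + 1) d) q - value (shift (i + 1) e) q) / q ^ (i + 1) :=
      div_pos (by linarith) (by positivity)
    have he' : value e q = x := he
    linarith

/-- In the switch region after the word `w` there are two expansions. -/
theorem notMem_univoqueBases {q x : ℝ} {w : List Bool}
    (h1 : value (prepend w (prepend [true] fun _ => false)) q ≤ x)
    (h2 : x ≤ value (prepend w zeroOnes) q) : q ∉ univoqueBases x := by
  rintro ⟨hq, hq2, hu⟩
  have hq0 : 0 < q := by linarith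
  rw [value_prepend hq, value_cons hq, value_zeros] at h1
  rw [value_prepend hq, value_zeroOnes hq] at h2
  set y := q * (q ^ w.length * (x - wordValue w q)) with hy
  have hx : x = wordValue w q + y / q / q ^ w.length := by rw [hy]; field_simp; ring
  have hP : 0 < q ^ w.length := by positivity
  rw [hx, add_le_add_iff_left, div_le_div_iff_of_pos_right hP,
    div_le_div_iff_of_pos_right hq0] at h1 h2
  simp only [if_true, add_zero] at h1
  obtain ⟨d, hd⟩ := exists_value_eq hq hq2 (by linarith) h2
  obtain ⟨e, he⟩ := exists_value_eq (y := y - 1) hq hq2 (by linarith) (by linarith)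
  have := hu.unique (y₁ := prepend w (prepend [false] d)) (y₂ := prepend w (prepend [true] e))
    (by rw [value_prepend hq, value_cons hq, hd, hx]; simp)
    (by rw [value_prepend hq, value_cons hq, he, hx]; simp)
  have h0 := congrFun this w.length
  have e1 := prepend_add w (prepend [false] d) 0
  have e2 := prepend_add w (prepend [true] e) 0
  rw [add_zero] at e1 e2
  rw [e1, e2] at h0
  simp [prepend] at h0

/-! ### Reflected tails of `α(q)` for univoque bases of one and their limits -/

/-- The reflected tails of `α(q)` after a digit `1` are small if one has a unique expansion. -/
theorem value_conj_shift_alpha_lt_one {q : ℝ} (hu : q ∈ univoqueBases 1) {i : ℕ}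
    (hi : alpha q i = true) : value (conj (shift (i + 1) (alpha q))) q < 1 := by
  obtain ⟨hq, hq2, hu⟩ := hu
  by_contra hge
  rw [not_lt, value_conj hq] at hge
  have hv := value_nonneg hq (shift (i + 1) (alpha q))
  -- If the reflected tail had value at least one, the digit `1` could be traded for `0` followed by
  -- an expansion `e` of one plus the old tail. This would be a second expansion of one.
  obtain ⟨e, he⟩ := exists_value_eq (y := 1 + value (shift (i + 1) (alpha q)) q) hq hq2
    (by linarith) (by linarith)
  have hq0 : 0 < q := by linarith
  set w : List Bool := (List.range i).map (alpha q) with hw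
  have hl : w.length = i := by simp [hw]
  have h1 : alpha q = prepend w (prepend [true] (shift (i + 1) (alpha q))) := by
    refine eq_prepend (fun j hj => ?_) (eq_prepend (fun j hj => ?_) ?_)
    · rw [hl] at hj; simp [hw, hj]
    · have : j = 0 := by simpa using hj
      subst this
      simp [shift, hl, hi]
    · rw [shift_shift, hl]; simp [add_comm]
  have h2 : value (alpha q) q = value (prepend w (prepend [false] e)) q := by
    conv_lhs => rw [h1]
    rw [value_prepend hq w, value_prepend hq w, value_cons hq, value_cons hq, he]
    simp
  have h3 := hu.unique (value_alpha hq hq2) (h2.symm.trans (value_alpha hq hq2))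
  have h4 := congrFun h3 i
  have e1 := prepend_add w (prepend [false] e) 0
  rw [add_zero, hl] at e1
  rw [e1, hi] at h4
  simp [prepend] at h4

/-- If one has a unique expansion, then all reflected tails of `α(q)` are smaller than `α(q)`. -/
theorem conj_shift_alpha_lt {q : ℝ} (hu : q ∈ univoqueBases 1) (n : ℕ) :
    SeqLT (conj (shift (n + 1) (alpha q))) (alpha q) := by
  have hq := hu.1
  have hq2 := hu.2.1
  refine lt_alpha_of_value_lt hq hq2 ?_
  induction n with
  | zero => exact value_conj_shift_alpha_lt_one hu (alpha_zero hq hq2)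
  | succ n ih =>
    cases h : alpha q (n + 1) with
    | true => exact value_conj_shift_alpha_lt_one hu h
    | false =>
      rw [conj_shift, value_shift hq, conj_apply, h, div_lt_iff₀ (by linarith)] at ih
      simp only [Bool.not_false, if_true] at ih
      rw [conj_shift]
      linarith

theorem seqLT_of_agree {a b a' b' : ℕ → Bool} {i : ℕ} (h : ∀ j < i, a j = b j)
    (ha : a i = false) (hb : b i = true) (haa : ∀ j ≤ i, a' j = a j) (hbb : ∀ j ≤ i, b' j = b j) :
    SeqLT a' b' :=
  ⟨i, fun j hj => by rw [haa j hj.le, hbb j hj.le, h j hj], (haa i le_rfl).trans ha,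
    (hbb i le_rfl).trans hb⟩

/-- A substitute for right continuity, which `α` lacks in general. In base `q` the value of `α(p)`
exceeds one by at most `1 / (q - 1) - 1 / (p - 1)`. An early first difference would make the excess
larger, because univoqueness of `p` bounds the tail of `α(p)` after a digit `1` from below. -/
theorem alpha_agree_of_univoque_gt {p q : ℝ} {L : ℕ} (hq : 1 < q) (hqp : q < p)
    (hp : p ∈ univoqueBases 1) (hL : q ^ L * (p - q) ≤ (2 - p) * (q - 1)) :
    ∀ j < L, alpha p j = alpha q j := by
  have hp1 := hp.1
  have hp2 := hp.2.1
  by_contra hne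
  push Not at hne
  classical
  have hex : ∃ j, j < L ∧ alpha p j ≠ alpha q j := hne
  obtain ⟨hj, hnej⟩ := Nat.find_spec hex
  have hmin : ∀ l < Nat.find hex, alpha p l = alpha q l := fun l hl => by
    by_contra hcon
    exact Nat.find_min hex hl ⟨hl.trans hj, hcon⟩
  generalize Nat.find hex = i at *
  have hlt := alpha_lt_alpha hq hqp hp2
  cases hpi : alpha p i with
  | false =>
    have hqi : alpha q i = true := by rw [hpi] at hnej; simpa using hnej.symm
    exact not_seqLT.2 hlt.le ⟨i, hmin, hpi, hqi⟩
  | true =>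
    have hqi : alpha q i = false := by rw [hpi] at hnej; simpa using hnej.symm
    have h1 := value_sub_of_first hq (fun l hl => (hmin l hl).symm) hqi hpi
    rw [value_alpha hq (hqp.le.trans hp2)] at h1
    have h2 := value_shift_alpha_le hq (hqp.le.trans hp2) (i + 1)
    have h3 := value_conj_shift_alpha_lt_one hp hpi
    rw [value_conj hp1] at h3
    have h4 := value_anti hq hqp.le (shift (i + 1) (alpha p))
    have h5 := value_anti hq hqp.le (conj (alpha p))
    rw [value_conj hq, value_conj hp1, value_alpha hp1 hp2] at h5
    have h6 : (1 / (p - 1) - 1) / q ^ L ≤ (1 / (p - 1) - 1) / q ^ (i + 1) :=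
      div_le_div_of_nonneg_left (by linarith [one_le_one_div hp1 hp2]) (by positivity)
        (pow_le_pow_right₀ hq.le (by omega))
    have h7 : (1 / (p - 1) - 1) / q ^ (i + 1) < (1 + value (shift (i + 1) (alpha p)) q
      - value (shift (i + 1) (alpha q)) q) / q ^ (i + 1) :=
      div_lt_div_of_pos_right (by linarith) (by positivity)
    have h8 : (1 / (p - 1) - 1) / q ^ L < 1 / (q - 1) - 1 / (p - 1) := by linarith
    have hp0 : 0 < p - 1 := by linarith
    have hq0 : 0 < q - 1 := by linarith
    have hqL : 0 < q ^ L := by positivity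
    have h9 : 1 / (p - 1) - 1 = (2 - p) / (p - 1) := by field_simp; ring
    have h10 : 1 / (q - 1) - 1 / (p - 1) = (p - q) / (q - 1) / (p - 1) := by field_simp; ring
    rw [h9, h10, div_div, mul_comm (p - 1), ← div_div, div_lt_div_iff_of_pos_right hp0,
      div_lt_div_iff₀ hqL hq0] at h8
    linarith

/-- Each base below `2` in the closure of the univoque bases of one has strictly small reflected
tails. -/
theorem conj_shift_alpha_lt_of_mem_closure {q : ℝ} (hq : 1 < q) (hq2 : q < 2)
    (hcl : q ∈ closure (univoqueBases 1)) (n : ℕ) :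
    SeqLT (conj (shift (n + 1) (alpha q))) (alpha q) := by
  by_contra hcon
  rw [not_seqLT] at hcon
  -- `L` covers the place where the inequality becomes strict or, in the case of equality, one full
  -- period `2 * (n + 1)` of `α(q)`.
  obtain ⟨L, hnL, hL⟩ : ∃ L, 2 * (n + 1) ≤ L ∧ ((alpha q = conj (shift (n + 1) (alpha q))) ∨
      ∃ i, i + (n + 1) < L ∧ (∀ j < i, alpha q j = conj (shift (n + 1) (alpha q)) j) ∧
        alpha q i = false ∧ conj (shift (n + 1) (alpha q)) i = true) := by
    rcases hcon with ⟨i, h⟩ | h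
    · exact ⟨i + 2 * (n + 1), by omega, Or.inr ⟨i, by omega, h⟩⟩
    · exact ⟨_, le_rfl, Or.inl h⟩
  obtain ⟨p₀, -, hp₀q, hp₀⟩ := exists_lt_alpha_agree hq hq2.le L
  have hD : 0 < q ^ L + (q - 1) := by
    have : 0 < q ^ L := by positivity
    linarith
  -- The radius on the right comes from solving the hypothesis `hL` of `alpha_agree_of_univoque_gt`
  -- for `p - q`.
  obtain ⟨p, ⟨hp₀p, hpδ⟩, hp⟩ := mem_closure_iff.1 hcl
    (Set.Ioo p₀ (q + (2 - q) * (q - 1) / (q ^ L + (q - 1)))) isOpen_Ioo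
    ⟨hp₀q, by
      have : 0 < (2 - q) * (q - 1) / (q ^ L + (q - 1)) :=
        div_pos (mul_pos (by linarith) (by linarith)) hD
      linarith⟩
  have hstrict := conj_shift_alpha_lt hp n
  have hagree : ∀ j < L, alpha p j = alpha q j := by
    rcases le_or_gt p q with hpq | hqp
    · exact hp₀ p hp₀p hpq
    · refine alpha_agree_of_univoque_gt hq hqp hp ?_
      have : (p - q) * (q ^ L + (q - 1)) ≤ (2 - q) * (q - 1) := by
        rw [← le_div_iff₀ hD]; linarith
      nlinarith
  rcases le_or_gt p q with hpq | hqp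
  · have h1 := alpha_le_alpha hp.1 hpq hq2.le
    have h2 : SeqLT (shift (n + 1) (alpha q)) (shift (n + 1) (alpha p)) := by
      have h3 := hstrict.conj
      have h4 := hcon.conj
      rw [conj_conj] at h3 h4
      exact (h4.trans h1.conj).trans_lt h3
    rw [seqLT_shift_iff fun j hj => (hagree j (by omega)).symm] at h2
    exact not_seqLT.2 h1 h2
  · rcases hL with heq | ⟨i, hiL, hij, hi0, hi1⟩
    -- With equality `α(q)` is periodic. At the first place where `α(p)` exceeds `α(q)`, the tail of
    -- `α(p)` shifted by one period exceeds `α(p)`, which is impossible.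
    · have hper : ∀ j, alpha q (j + 2 * (n + 1)) = alpha q j := by
        intro j
        have e1 := congrFun heq j
        have e2 := congrFun heq (j + (n + 1))
        rw [conj_apply, shift_apply] at e1 e2
        rw [e1, e2, Bool.not_not]
        congr 1; ring
      obtain ⟨i, hij, hi0, hi1⟩ := alpha_lt_alpha hq hqp hp.2.1
      have hLi : L ≤ i := by
        by_contra hlt
        have := hagree i (by omega)
        simp [hi0, hi1] at this
      refine not_seqLT.2 (shift_alpha_le hp.1 hp.2.1 (2 * (n + 1)))
        ⟨i - 2 * (n + 1), fun j hj => ?_, ?_, ?_⟩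
      · rw [shift_apply, ← hij _ (by omega), ← hij _ (by omega), hper]
      · rw [← hij _ (by omega), ← hper, Nat.sub_add_cancel (by omega), hi0]
      · rw [shift_apply, Nat.sub_add_cancel (by omega), hi1]
    · refine not_seqLT.2 hstrict.le (seqLT_of_agree hij hi0 hi1 (fun j hj => hagree j (by omega))
        fun j hj => ?_)
      rw [conj_apply, conj_apply, shift_apply, shift_apply, hagree _ (by omega)]

/-! ### Critical shifts and their blocks -/

/-- `N` is the least shift for which the reflected tail of `a` is at least `a`. -/
structure IsCritical (a : ℕ → Bool) (N : ℕ) : Prop where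
  shift_le : ∀ n, SeqLE (shift n a) a
  pos : 0 < N
  le : SeqLE a (conj (shift N a))
  lt : ∀ M < N, SeqLT (conj (shift M a)) a

namespace IsCritical

variable {a : ℕ → Bool} {N : ℕ}

theorem apply_zero (h : IsCritical a N) : a 0 = true := by
  by_contra h0
  rw [Bool.not_eq_true] at h0
  obtain ⟨i, hj, h1, h2⟩ := h.lt 0 h.pos
  rw [shift_zero] at hj h1
  rcases Nat.eq_zero_or_pos i with rfl | hi
  · simp [h0] at h2
  · have := hj 0 hi
    simp [conj_apply] at this

/-- If this digit were `0`, the reflected tail from `N - 1` would start with `1` like `a`.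
Cancelling this digit gives that the reflected tail from `N` is `≺ σ(a) ≼ a`, against `le`. -/
theorem apply_pred (h : IsCritical a N) : a (N - 1) = true := by
  by_contra h0
  rw [Bool.not_eq_true] at h0
  have hpos := h.pos
  have h1 := h.lt (N - 1) (by omega)
  have h2 : ∀ j < 1, conj (shift (N - 1) a) j = a j := by
    intro j hj
    obtain rfl : j = 0 := by omega
    simp [conj_apply, shift_apply, h0, h.apply_zero]
  rw [← seqLT_shift_iff h2, ← conj_shift, shift_shift, show 1 + (N - 1) = N by omega] at h1
  exact not_seqLT.2 h.le (h1.trans_le (h.shift_le 1))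

/-- If `a' ≽ a` has the critical shift `M < N`, then the words of length `M` differ. -/
theorem exists_ne (h : IsCritical a N) {a' : ℕ → Bool} {M : ℕ} (hM : M < N)
    (haa : SeqLE a a') (hle : SeqLE a' (conj (shift M a'))) : ∃ j < M, a j ≠ a' j := by
  by_contra hne
  push Not at hne
  have h1 := (h.lt M hM).conj
  have h2 := hle.conj
  rw [conj_conj] at h1 h2
  have h3 := (h2.trans haa.conj).trans_lt h1
  rw [seqLT_shift_iff fun j hj => (hne j hj).symm] at h3
  exact not_seqLT.2 haa h3

/-- The conditions after a digit `1` of the block. -/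
theorem tail_lt_of_true (h : IsCritical a N) {t : ℕ} (ht : t < N) {T : ℕ → Bool}
    (hT : ∀ s < N - 1 - t, T s = !a (t + s)) (hT0 : T (N - 1 - t) = true) :
    SeqLT (conj T) a := by
  refine SeqLT.trans_le (b := shift t a) ⟨N - 1 - t, fun s hs => ?_, ?_, ?_⟩ (h.shift_le t)
  · rw [conj_apply, hT s hs, Bool.not_not, shift_apply, add_comm]
  · rw [conj_apply, hT0, Bool.not_true]
  · rw [shift_apply, show N - 1 - t + t = N - 1 by omega, h.apply_pred]

/-- The conditions after a digit `0` of the block. Here `T'` is the sequence that follows the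
block; it starts with `1` and does not exceed `1` followed by the reflection of `a`. -/
theorem tail_lt_of_false (h : IsCritical a N) {t : ℕ} (ht : t + 1 < N) {T T' : ℕ → Bool}
    (hT : ∀ s < N - 2 - t, T s = !a (t + 1 + s)) (hT' : shift (N - 2 - t) T = T')
    (hT0 : T' 0 = true) (hle : PrefixLE N T' (prepend [true] (conj a))) : SeqLT T a := by
  obtain ⟨l, rfl⟩ : ∃ l, N = t + 1 + l := ⟨N - (t + 1), by omega⟩
  have hl : 0 < l := by omega
  rw [show t + 1 + l - 2 - t = l - 1 by omega] at hT hT'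
  have hTl : T (l - 1) = true := by
    have := congrFun hT' 0
    rw [shift_apply, zero_add] at this
    rw [this, hT0]
  have hpred : a (t + l) = true := by
    have := h.apply_pred
    rwa [show t + 1 + l - 1 = t + l by omega] at this
  obtain ⟨i, hij, hi0, hi1⟩ := h.lt (t + 1) (by omega)
  -- The cases place the first difference `i` relative to the end of the block. Before the end it
  -- decides at once. At the end, `T` matches `a` through the first digit of `T'`, and the bound on
  -- `T'` decides. Beyond the end, the reflected tail from `N` would be `≺ σ^l(a) ≼ a`, against
  -- `le`.
  rcases lt_trichotomy i (l - 1) with hi | hi | hi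
  · refine ⟨i, fun s hs => ?_, ?_, hi1⟩
    · rw [hT s (by omega), ← hij s hs, conj_apply, shift_apply, add_comm]
    · rw [hT i hi, ← hi0, conj_apply, shift_apply, add_comm]
  · subst hi
    have hpre : ∀ s < l, T s = a s := by
      intro s hs
      rcases Nat.lt_or_ge s (l - 1) with hs' | hs'
      · rw [hT s hs', ← hij s hs', conj_apply, shift_apply, add_comm]
      · rw [show s = l - 1 by omega, hTl, hi1]
    rw [← seqLT_shift_iff hpre]
    obtain ⟨i, hi, hi0, hi1⟩ := h.lt l (by omega)
    have hiN : i < t + 1 := by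
      by_contra hge
      refine not_seqLT.2 h.le (SeqLT.trans_le (b := shift (t + 1) a)
        ⟨i - (t + 1), fun s hs => ?_, ?_, ?_⟩ (h.shift_le _))
      · rw [shift_apply, ← hi _ (by omega), conj_apply, conj_apply, shift_apply, shift_apply]
        congr 2; omega
      · rw [← hi0, conj_apply, conj_apply, shift_apply, shift_apply]
        congr 2; omega
      · rw [shift_apply, Nat.sub_add_cancel (by omega), hi1]
    have hle' : PrefixLE (t + l) (shift l T) (conj a) := by
      intro s hs hj h1
      have hTT : ∀ r, T' (r + 1) = shift l T r := fun r => by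
        rw [← hT', shift_apply, shift_apply]; congr 1; omega
      have := hle (s + 1) (by omega) (fun j hjs => ?_) (by rw [hTT, h1])
      · simpa [prepend] using this
      · rcases Nat.eq_zero_or_pos j with rfl | hj0
        · simp [hT0, prepend]
        · obtain ⟨r, rfl⟩ := Nat.exists_eq_add_of_lt hj0
          rw [zero_add, hTT, hj r (by omega)]
          simp [prepend]
    refine hle'.lt_of_lt (i := i) (by omega) (fun j hj => ?_) ?_ ?_
    · rw [conj_apply, ← hi j hj, conj_apply, Bool.not_not]
    · rw [conj_apply, hi1]; rfl
    · rwa [conj_apply, Bool.not_eq_false'] at hi0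
  · exfalso
    have hpre : ∀ j < l, conj (shift (t + 1) a) j = a j := fun j hj => hij j (by omega)
    have h1 : SeqLT (conj (shift (t + 1) a)) a := h.lt (t + 1) (by omega)
    rw [← seqLT_shift_iff hpre, ← conj_shift, shift_shift, add_comm l] at h1
    exact not_seqLT.2 h.le (h1.trans_le (h.shift_le l))

end IsCritical

/-- The first `N` digits of `1` followed by the reflection of `a`. -/
def critBlock (a : ℕ → Bool) (N : ℕ) : List Bool :=
  (List.range N).map (prepend [true] (conj a))

theorem length_critBlock (a : ℕ → Bool) (N : ℕ) : (critBlock a N).length = N := by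
  simp [critBlock]

theorem prepend_critBlock {a : ℕ → Bool} {N : ℕ} {T : ℕ → Bool} {i : ℕ} (hi : i < N) :
    prepend (critBlock a N) T i = prepend [true] (conj a) i := by
  rw [prepend_lt (by rwa [length_critBlock]), critBlock]
  simp [List.getD, hi]

theorem prepend_true_zero (d : ℕ → Bool) : prepend [true] d 0 = true := by simp [prepend]

theorem prepend_singleton_succ (b : Bool) (d : ℕ → Bool) (i : ℕ) :
    prepend [b] d (i + 1) = d i := by simp [prepend]

/-! ### Concatenations of critical blocks are univoque -/

/-- A family of sequences in which `T i` is either the critical block of `a i` followed by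
`T (i + 1)` or a prescribed end sequence. -/
structure BlockFamily (A : ℕ → Bool) (a : ℕ → ℕ → Bool) (N : ℕ → ℕ) (T : ℕ → ℕ → Bool) :
    Prop where
  mono : ∀ i j, i ≤ j → SeqLE (a i) (a j)
  le : ∀ i, SeqLE (a i) A
  apply_zero : ∀ i, T i 0 = true
  step : ∀ i, (IsCritical (a i) (N i) ∧ T i = prepend (critBlock (a i) (N i)) (T (i + 1))) ∨
    (N i = 0 ∧ LexUnivoque A (T i) ∧ ∀ j ≤ i, PrefixLE (N j) (T i) (prepend [true] (conj (a j))))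

theorem prepend_true_le {a b : ℕ → Bool} (h : SeqLE a b) :
    SeqLE (prepend [true] a) (prepend [true] b) := by
  rw [← seqLE_shift_iff (n := 1) (fun j hj => by
    obtain rfl : j = 0 := by omega
    simp [prepend_true_zero])]
  exact h

namespace BlockFamily

variable {A : ℕ → Bool} {a : ℕ → ℕ → Bool} {N : ℕ → ℕ} {T : ℕ → ℕ → Bool}

/-- Within the block of `T i'` the bound follows from `a i ≼ a i'`. If equality lasts through that
block, what remains is `T (i' + 1)`, to be compared with `1` and a reflected tail of `a i`. Since
that tail is `≽` the reflection of `a i`, the bound for a shorter length suffices. -/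
theorem prefixLE (h : BlockFamily A a N T) (L : ℕ) : ∀ i i', i ≤ i' → L ≤ N i →
    PrefixLE L (T i') (prepend [true] (conj (a i))) := by
  induction L using Nat.strong_induction_on with
  | _ L ih =>
    intro i i' hii hL
    rcases h.step i' with ⟨hc', hT⟩ | ⟨-, -, hend⟩
    swap
    · exact (hend i hii).mono hL
    have hagree : ∀ s < N i', T i' s = prepend [true] (conj (a i')) s := fun s hs => by
      rw [hT, prepend_critBlock hs]
    have hle := prepend_true_le (h.mono i i' hii).conj
    intro s hs hj h1
    by_cases hsN : s < N i'
    · exact ((hle.prefixLE (N i')).congr_left hagree) s hsN hj h1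
    · rw [not_lt] at hsN
      have hpos := hc'.pos
      have hp := hc'.apply_pred
      have hdig : ∀ j, j + 1 < N i' → a i j = a i' j := fun j hjN => by
        have e1 := hagree (j + 1) hjN
        rw [hj (j + 1) (by omega), prepend_singleton_succ, prepend_singleton_succ, conj_apply,
          conj_apply] at e1
        exact Bool.not_inj e1
      rcases h.step i with ⟨hc, -⟩ | ⟨hNi, -⟩
      swap
      · omega
      -- A shift smaller than `N i` can be critical for `a i'` only if the words of that length
      -- differ. They agree before the last digit, and there `a i'` has `1`.
      have hfalse : a i (N i' - 1) = false := by
        by_contra htrue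
        rw [Bool.not_eq_false] at htrue
        obtain ⟨j, hjN, hne⟩ := hc.exists_ne (by omega) (h.mono i i' hii) hc'.le
        rcases Nat.lt_or_ge (j + 1) (N i') with hj' | hj'
        · exact hne (hdig j hj')
        · rw [show j = N i' - 1 by omega, htrue, hp] at hne
          exact hne rfl
      have hval : ∀ u, prepend [true] (conj (a i)) (N i' + u + 1)
          = conj (shift (N i') (a i)) u := fun u => by
        rw [prepend_singleton_succ, conj_apply, conj_apply, shift_apply, add_comm]
      have hzero : prepend [true] (conj (a i)) (N i') = true := by
        obtain ⟨M, hM⟩ := Nat.exists_eq_add_of_lt hpos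
        rw [hM] at hfalse ⊢
        rw [prepend_singleton_succ, conj_apply]
        simpa using hfalse
      obtain ⟨u, rfl⟩ := Nat.exists_eq_add_of_le hsN
      have hnext : ∀ v, T i' (N i' + v) = T (i' + 1) v := fun v => by
        have := prepend_add (critBlock (a i') (N i')) (T (i' + 1)) v
        rwa [length_critBlock, ← hT] at this
      have hshift : ∀ v, prepend [true] (conj (a i)) (N i' + v)
          = prepend [true] (conj (shift (N i') (a i))) v := fun v => by
        rcases Nat.eq_zero_or_pos v with rfl | hv
        · rw [add_zero, hzero, prepend_true_zero]
        · obtain ⟨r, rfl⟩ := Nat.exists_eq_add_of_lt hv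
          rw [zero_add, ← add_assoc, hval, prepend_singleton_succ]
      have hIH := ih (L - N i') (by omega) i (i' + 1) (by omega) (by omega)
      have htr := hIH.trans
        ((prepend_true_le (hc.shift_le (N i')).conj).prefixLE (L - N i'))
      rw [hshift]
      refine htr u (by omega) (fun j hju => ?_) (by rw [← hnext, h1])
      rw [← hnext, hj _ (by omega), hshift]

theorem lexUnivoque (h : BlockFamily A a N T) (i : ℕ) : LexUnivoque A (T i) := by
  intro m
  induction m using Nat.strong_induction_on generalizing i with
  | _ m ih =>
    rcases h.step i with ⟨hc, hT⟩ | ⟨-, hend, -⟩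
    swap
    · exact hend m
    have hpos := hc.pos
    have hagree : ∀ s < N i, T i s = prepend [true] (conj (a i)) s := fun s hs => by
      rw [hT, prepend_critBlock hs]
    have hsucc : ∀ s, s + 1 < N i → T i (s + 1) = !a i s := fun s hs => by
      rw [hagree _ hs, prepend_singleton_succ, conj_apply]
    have hnext : shift (N i) (T i) = T (i + 1) := by
      conv_lhs => rw [hT]
      have := shift_prepend (critBlock (a i) (N i)) (T (i + 1))
      rwa [length_critBlock] at this
    rcases Nat.lt_or_ge m (N i) with hm | hm
    · constructor
      · intro h0
        have hm0 : m ≠ 0 := by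
          rintro rfl
          rw [hagree 0 hm, prepend_true_zero] at h0
          simp at h0
        obtain ⟨t, rfl⟩ := Nat.exists_eq_succ_of_ne_zero hm0
        refine (hc.tail_lt_of_false (t := t) (T' := T (i + 1)) hm (fun s hs => ?_) ?_
          (h.apply_zero _) (h.prefixLE _ i (i + 1) (by omega) le_rfl)).trans_le (h.le i)
        · rw [shift_apply, show s + (t.succ + 1) = (t + 1 + s) + 1 by omega, hsucc _ (by omega)]
        · rw [shift_shift, show N i - 2 - t + (t.succ + 1) = N i by omega, hnext]
      · intro _
        refine (hc.tail_lt_of_true hm (fun s hs => ?_) ?_).trans_le (h.le i)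
        · rw [shift_apply, show s + (m + 1) = (m + s) + 1 by omega, hsucc _ (by omega)]
        · rw [shift_apply, show N i - 1 - m + (m + 1) = 0 + N i by omega, ← shift_apply (T i), hnext,
            h.apply_zero]
    · obtain ⟨u, rfl⟩ := Nat.exists_eq_add_of_le hm
      have := ih u (by omega) (i + 1)
      rw [← hnext, shift_shift, shift_apply] at this
      rwa [show u + N i = N i + u by omega, show u + 1 + N i = N i + u + 1 by omega] at this

/-- Leading zeros are harmless. -/
theorem lexUnivoque_replicate (h : BlockFamily A a N T) (hA0 : A 0 = true) (hA1 : A 1 = true)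
    (hT1 : T 0 1 = false) (l : ℕ) :
    LexUnivoque A (prepend (List.replicate l false) (T 0)) := by
  induction l with
  | zero => simpa [prepend_nil] using h.lexUnivoque 0
  | succ l ih =>
    have heq : prepend (List.replicate (l + 1) false) (T 0)
        = prepend [false] (prepend (List.replicate l false) (T 0)) := by
      rw [← prepend_append]; rfl
    rw [heq]
    intro m
    cases m with
    | zero =>
      refine ⟨fun _ => ?_, fun h1 => by simp [prepend] at h1⟩
      rw [show shift (0 + 1) (prepend [false] _) = _ from shift_prepend [false] _]
      cases l with
      | zero =>
        rw [List.replicate_zero, prepend_nil]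
        refine ⟨1, fun j hj => ?_, hT1, hA1⟩
        obtain rfl : j = 0 := by omega
        rw [h.apply_zero, hA0]
      | succ l => exact ⟨0, by simp, by simp [prepend, List.replicate_succ], hA0⟩
    | succ m =>
      rw [prepend_singleton_succ, ← shift_shift (m + 1) 1,
        show shift 1 (prepend [false] _) = _ from shift_prepend [false] _]
      exact ih m

end BlockFamily

/-! ### Reflection-free prefixes and approximation by `(v v̄)^∞` -/

/-- No suffix of the word of the first `M` digits of `a` is the reflection of a prefix. -/
def IsReflectionFree (a : ℕ → Bool) (M : ℕ) : Prop :=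
  ∀ k < M, ∃ i, k + i < M ∧ a (k + i) = a i

/-- If `n` fails, take the longest bad suffix, starting at `k`, and extend the word to the first
place where the reflected tail from `k` drops below `a`. A bad suffix starting later would then
yield a tail of `a` larger than `a`. -/
theorem exists_isReflectionFree {a : ℕ → Bool} (hs : ∀ n, SeqLE (shift n a) a)
    (hc : ∀ n, SeqLT (conj (shift n a)) a) (n : ℕ) : ∃ M, n ≤ M ∧ IsReflectionFree a M := by
  by_cases hn : IsReflectionFree a n
  · exact ⟨n, le_rfl, hn⟩
  unfold IsReflectionFree at hn
  push Not at hn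
  classical
  obtain ⟨hk, hkn⟩ := Nat.find_spec hn
  have hmin : ∀ l < Nat.find hn, l < n → ∃ i, l + i < n ∧ a (l + i) = a i := by
    intro l hl hln
    have := Nat.find_min hn hl
    push Not at this
    exact this hln
  generalize Nat.find hn = k at *
  obtain ⟨i₀, hi, hi0, hi1⟩ := hc k
  have hki : a (i₀ + k) = true := by rw [conj_apply, shift_apply] at hi0; simpa using hi0
  have hni : n ≤ k + i₀ := by
    by_contra hlt
    exact hkn i₀ (by omega) (by rw [add_comm, hki, hi1])
  refine ⟨k + i₀ + 1, by omega, fun l hl => ?_⟩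
  by_contra hno
  push Not at hno
  rcases lt_trichotomy l k with hlk | rfl | hkl
  · obtain ⟨i, hin, hai⟩ := hmin l hlk (by omega)
    exact hno i (by omega) hai
  · exact hno i₀ (by omega) (by rw [add_comm, hki, hi1])
  · obtain ⟨e, rfl⟩ := Nat.exists_eq_add_of_lt hkl
    refine not_seqLT.2 (hs (e + 1)) ⟨i₀ - (e + 1), fun i hii => ?_, ?_, ?_⟩
    · have h1 := hno i (by omega)
      have h2 := hi (i + (e + 1)) (by omega)
      rw [conj_apply, shift_apply] at h2
      rw [shift_apply, ← h2, show i + (e + 1) + k = k + e + 1 + i by omega]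
      cases h3 : a (k + e + 1 + i) <;> cases h4 : a i <;> simp_all
    · have h1 := hno (i₀ - (e + 1)) (by omega)
      rw [show k + e + 1 + (i₀ - (e + 1)) = i₀ + k by omega, hki] at h1
      simpa using h1.symm
    · rw [shift_apply, Nat.sub_add_cancel (by omega), hi1]

/-- The sequence `(v v̄)^∞`, where `v` is the word of the first `M` digits of `a`. -/
def reflectPeriodic (a : ℕ → Bool) (M : ℕ) : ℕ → Bool :=
  fun m => if (m / M) % 2 = 0 then a (m % M) else !a (m % M)

theorem reflectPeriodic_of_lt {a : ℕ → Bool} {M m : ℕ} (h : m < M) :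
    reflectPeriodic a M m = a m := by
  simp [reflectPeriodic, Nat.div_eq_of_lt h, Nat.mod_eq_of_lt h]

theorem reflectPeriodic_add {a : ℕ → Bool} {M : ℕ} (hM : 0 < M) (m : ℕ) :
    reflectPeriodic a M (m + M) = !reflectPeriodic a M m := by
  simp only [reflectPeriodic, Nat.add_div_right m hM, Nat.add_mod_right]
  rcases Nat.mod_two_eq_zero_or_one (m / M) with h | h
  · have : (m / M).succ % 2 = 1 := by omega
    simp [h, this]
  · have : (m / M).succ % 2 = 0 := by omega
    simp [h, this]

theorem shift_reflectPeriodic_lt {a : ℕ → Bool} {M : ℕ} (hM : 0 < M)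
    (hs : ∀ n, SeqLE (shift n a) a) (hc : ∀ n, SeqLT (conj (shift n a)) a)
    (hfree : IsReflectionFree a M) (s : ℕ) :
    SeqLT (shift s (reflectPeriodic a M)) a ∧ SeqLT (conj (shift s (reflectPeriodic a M))) a := by
  have hconj : ∀ s, shift (s + M) (reflectPeriodic a M)
      = conj (shift s (reflectPeriodic a M)) := fun s => by
    funext i
    rw [shift_apply, conj_apply, shift_apply, ← add_assoc, reflectPeriodic_add hM]
  induction s using Nat.strong_induction_on with
  | _ s ih =>
    rcases Nat.lt_or_ge s M with hsM | hsM
    swap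
    · obtain ⟨t, rfl⟩ := Nat.exists_eq_add_of_le' hsM
      rw [hconj, conj_conj]
      exact (ih t (by omega)).symm
    have hagree : ∀ i, i + s < M → shift s (reflectPeriodic a M) i = a (i + s) := fun i hi => by
      rw [shift_apply, reflectPeriodic_of_lt hi]
    have hdiff : ∀ k < M, ∃ i, k + i < M ∧ (∀ j < i, a (k + j) = !a j) ∧ a (k + i) = true ∧
        a i = true := by
      intro k hk
      obtain ⟨i, hi, hi0, hi1⟩ := hc k
      obtain ⟨l, hl, hal⟩ := hfree k hk
      have hil : i ≤ l := by
        by_contra hlt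
        have := hi l (by omega)
        rw [conj_apply, shift_apply, add_comm, hal] at this
        simp at this
      refine ⟨i, by omega, fun j hj => ?_, ?_, hi1⟩
      · rw [← hi j hj, conj_apply, shift_apply, add_comm, Bool.not_not]
      · rw [conj_apply, shift_apply, add_comm] at hi0
        simpa using hi0
    constructor
    swap
    · obtain ⟨i, hi, hij, hi0, hi1⟩ := hdiff s hsM
      refine ⟨i, fun j hj => ?_, ?_, hi1⟩
      · rw [conj_apply, hagree j (by omega), add_comm, hij j hj, Bool.not_not]
      · rw [conj_apply, hagree i (by omega), add_comm, hi0, Bool.not_true]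
    · rcases Nat.eq_zero_or_pos s with rfl | hs0
      · rw [← not_seqLE]
        intro hle
        have h1 := hle.conj.trans_lt (by simpa [conj_conj] using (hc M).conj)
        rw [shift_zero, ← shift_zero (reflectPeriodic a M), ← hconj, zero_add,
          seqLT_shift_iff fun j hj => reflectPeriodic_of_lt hj] at h1
        exact not_seqLT.2 hle h1
      -- If the suffix of `v` from `s` is a prefix of `a`, the comparison moves on to `v̄` against
      -- `a` shifted by `M - s`, and reflection-freeness at `M - s` decides it.
      · by_cases hpre : ∀ i, i + s < M → a (i + s) = a i
        · obtain ⟨i, hi, hij, hi0, hi1⟩ := hdiff (M - s) (by omega)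
          have hlow : ∀ j < M, shift s (reflectPeriodic a M) (M - s + j) = !a j := fun j hj => by
            rw [shift_apply, show M - s + j + s = j + M by omega, reflectPeriodic_add hM,
              reflectPeriodic_of_lt hj]
          refine ⟨M - s + i, fun j hj => ?_, ?_, hi0⟩
          · rcases Nat.lt_or_ge (j + s) M with hj' | hj'
            · rw [hagree j hj', hpre j hj']
            · obtain ⟨u, rfl⟩ := Nat.exists_eq_add_of_le (show M - s ≤ j by omega)
              rw [hlow u (by omega), hij u (by omega)]
          · rw [hlow i (by omega), hi1, Bool.not_true]
        · push Not at hpre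
          obtain ⟨l, hl, hal⟩ := hpre
          rcases hs s with ⟨i, hi, hi0, hi1⟩ | heq
          · have hil : i ≤ l := by
              by_contra hlt
              exact hal (hi l (by omega))
            refine ⟨i, fun j hj => ?_, ?_, hi1⟩
            · rw [hagree j (by omega), ← hi j hj, shift_apply]
            · rw [hagree i (by omega), ← hi0, shift_apply]
          · exact absurd (congrFun heq l) hal

/-- The sequence `1` followed by the reflection of `(v v̄)^∞` is univoque. -/
theorem lexUnivoque_reflectPeriodic {a : ℕ → Bool} {M : ℕ} (hM : 0 < M)
    (hs : ∀ n, SeqLE (shift n a) a) (hc : ∀ n, SeqLT (conj (shift n a)) a)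
    (hfree : IsReflectionFree a M) :
    LexUnivoque a (prepend [true] (conj (reflectPeriodic a M))) := by
  intro m
  have h : shift (m + 1) (prepend [true] (conj (reflectPeriodic a M)))
      = conj (shift m (reflectPeriodic a M)) := by
    rw [← shift_shift, show shift 1 (prepend [true] _) = _ from shift_prepend [true] _, conj_shift]
  rw [h, conj_conj]
  have := shift_reflectPeriodic_lt hM hs hc hfree m
  exact ⟨fun _ => this.2, fun _ => this.1⟩

/-! ### The index and the block of the algorithm as critical data -/

theorem IsN.two_le {q : ℝ} (hq : 1 < q) (hq2 : q ≤ 2) {n : ℕ} (h : IsN q n) : 2 ≤ n := by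
  obtain ⟨⟨h1, h2⟩, -⟩ := h
  by_contra hlt
  obtain rfl : n = 1 := by omega
  have h0 := alpha_zero hq hq2
  exact not_seqLT.2 h2 ⟨0, by simp, by simp [conj_apply, shift_apply, h0], h0⟩

/-- The algorithm numbers digits from one, so the index `n` belongs to the shift `n - 1`. -/
theorem IsN.isCritical {q : ℝ} (hq : 1 < q) (hq2 : q ≤ 2) {n : ℕ} (h : IsN q n) :
    IsCritical (alpha q) (n - 1) := by
  have h2 := h.two_le hq hq2
  refine ⟨shift_alpha_le hq hq2, by omega, h.1.2, fun M hM => ?_⟩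
  rw [← not_seqLE]
  intro hle
  have : n ≤ M + 1 := h.2 ⟨by omega, by simpa using hle⟩
  omega

theorem IsCritical.isN {q : ℝ} {N : ℕ} (h : IsCritical (alpha q) N) : IsN q (N + 1) := by
  refine ⟨⟨by omega, by simpa using h.le⟩, fun m hm => ?_⟩
  by_contra hlt
  obtain ⟨h1, h2⟩ := hm
  exact not_seqLE.2 (h.lt (m - 1) (by omega)) h2

theorem IsN.unique {q : ℝ} {m n : ℕ} (hm : IsN q m) (hn : IsN q n) : m = n :=
  IsLeast.unique hm hn

theorem block_eq_critBlock {q : ℝ} {n : ℕ} (hn : 2 ≤ n) :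
    block q n = critBlock (alpha q) (n - 1) := by
  obtain ⟨N, rfl⟩ := Nat.exists_eq_add_of_le' hn
  rw [block, critBlock, show N + 2 - 1 = N + 1 by omega, List.range_succ_eq_map, List.map_cons,
    List.map_map]
  congr 1
  simp only [segment]
  rw [show N + 2 - 2 + 1 - 1 = N by omega]
  refine List.map_congr_left fun t _ => ?_
  simp only [Function.comp_apply, prepend_singleton_succ]
  congr 1; omega

theorem exists_isN {q : ℝ} {n : ℕ} (h : SeqLE (alpha q) (conj (shift n (alpha q)))) :
    ∃ n, IsN q n := by
  classical
  have hex : ∃ n, 1 ≤ n ∧ SeqLE (alpha q) (conj (shift (n - 1) (alpha q))) :=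
    ⟨n + 1, by omega, by simpa using h⟩
  exact ⟨Nat.find hex, Nat.find_spec hex, fun m hm => Nat.find_min' hex hm⟩

/-! ### Comparing the continuations of a word -/

theorem value_prepend_le_iff {q : ℝ} (hq : 1 < q) {w : List Bool} {d e : ℕ → Bool} :
    value (prepend w d) q ≤ value (prepend w e) q ↔ value d q ≤ value e q := by
  rw [value_prepend hq, value_prepend hq, add_le_add_iff_left,
    div_le_div_iff_of_pos_right (by positivity)]

theorem value_prepend_lt_iff {q : ℝ} (hq : 1 < q) {w : List Bool} {d e : ℕ → Bool} :
    value (prepend w d) q < value (prepend w e) q ↔ value d q < value e q := by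
  rw [value_prepend hq, value_prepend hq, add_lt_add_iff_left,
    div_lt_div_iff_of_pos_right (by positivity)]

theorem value_true_conj_alpha {q : ℝ} (hq : 1 < q) (hq2 : q ≤ 2) :
    value (prepend [true] (conj (alpha q))) q = value zeroOnes q := by
  rw [value_cons hq, value_conj hq, value_alpha hq hq2, value_zeroOnes hq]
  simp

theorem prepend_true_conj {a : ℕ → Bool} {N : ℕ} (h : IsCritical a N) :
    prepend [true] (conj a)
      = prepend (critBlock a N) (prepend [false] (conj (shift N a))) := by
  have hpos := h.pos
  refine eq_prepend (fun i hi => ?_) (eq_prepend (fun i hi => ?_) ?_)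
  · rw [length_critBlock] at hi
    simp [critBlock, List.getD, hi]
  · obtain rfl : i = 0 := by simpa using hi
    rw [shift_apply, length_critBlock, show 0 + N = N - 1 + 1 by omega, prepend_singleton_succ,
      conj_apply, h.apply_pred]
    rfl
  · rw [shift_shift, length_critBlock]
    funext i
    rw [shift_apply, show i + ([false].length + N) = (i + N) + 1 by simp; omega,
      prepend_singleton_succ, conj_apply, conj_apply, shift_apply]

theorem critBlock_ne_nil {a : ℕ → Bool} {N : ℕ} (h : IsCritical a N) : critBlock a N ≠ [] := by
  have hpos := h.pos
  exact List.ne_nil_of_length_pos (by rwa [length_critBlock])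

theorem periodic_critBlock_zero {a : ℕ → Bool} {N : ℕ} (h : IsCritical a N) :
    periodic (critBlock a N) 0 = true := by
  rw [← prepend_periodic (critBlock_ne_nil h), prepend_critBlock h.pos, prepend_true_zero]

theorem blockFamily_periodic {A a : ℕ → Bool} {N : ℕ} (h : IsCritical a N) (hA : SeqLE a A) :
    BlockFamily A (fun _ => a) (fun _ => N) (fun _ => periodic (critBlock a N)) where
  mono _ _ _ := SeqLE.refl _
  le _ := hA
  apply_zero _ := periodic_critBlock_zero h
  step _ := Or.inl ⟨h, (prepend_periodic (critBlock_ne_nil h)).symm⟩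

/-- The value of the periodic continuation of the block is large. -/
theorem value_zeroOnes_lt_periodic {q : ℝ} (hq : 1 < q) (hq2 : q ≤ 2) {a : ℕ → Bool} {N : ℕ}
    (h : IsCritical a N) (ha : SeqLE a (alpha q)) :
    value zeroOnes q < value (periodic (critBlock a N)) q := by
  have h1 := ((blockFamily_periodic h ha).lexUnivoque 0).value_conj_lt_one hq hq2
    (periodic_critBlock_zero h)
  rw [value_conj hq] at h1
  rw [value_zeroOnes hq, value_succ hq (periodic _), periodic_critBlock_zero h,
    div_lt_div_iff_of_pos_right (by linarith)]
  simp only [if_true]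
  simp only [zero_add] at h1
  linarith

/-- This keeps the upper bound `r` of a step within `(1, 2]`. -/
theorem value_two_periodic_le {q : ℝ} (hq : Real.goldenRatio < q) (hq2 : q < 2) {N : ℕ}
    (h : IsCritical (alpha q) N) :
    value (periodic (critBlock (alpha q) N)) 2 ≤ value zeroOnes q := by
  have hq1 : 1 < q := Real.one_lt_goldenRatio.trans hq
  have hq0 : 0 < q - 1 := by linarith
  have h0 := alpha_zero hq1 hq2.le
  have h1 := alpha_one hq hq2.le
  set P := value (periodic (critBlock (alpha q) N)) 2 with hP
  set D := value (conj (alpha q)) 2 with hD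
  have hv2 : value (alpha q) 2 = 1 - D := by
    rw [hD, value_conj one_lt_two]; norm_num
  -- The periodic sequence and `1` followed by the reflection of `α(q)` share the block. Behind it
  -- they continue with the periodic sequence itself and with `0` followed by a reflected tail whose
  -- base `2` value is at least `1 - D`.
  have hP2 : P ≤ (1 + D) / 2 + (P - (1 - D) / 2) / 2 ^ N := by
    have e1 := value_sub_value one_lt_two (d := periodic (critBlock (alpha q) N))
      (e := prepend [true] (conj (alpha q))) (n := N) (fun j hj => by
        rw [← prepend_periodic (critBlock_ne_nil h), prepend_critBlock hj])
    have e2 : shift N (periodic (critBlock (alpha q) N)) = periodic (critBlock (alpha q) N) := by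
      have := shift_prepend (critBlock (alpha q) N) (periodic (critBlock (alpha q) N))
      rwa [prepend_periodic (critBlock_ne_nil h), length_critBlock] at this
    have e3 : shift N (prepend [true] (conj (alpha q)))
        = prepend [false] (conj (shift N (alpha q))) := by
      have := shift_prepend (critBlock (alpha q) N) (prepend [false] (conj (shift N (alpha q))))
      rwa [← prepend_true_conj h, length_critBlock] at this
    have e4 : value (shift N (alpha q)) 2 ≤ D := by
      refine value_two_mono ?_
      have := h.le.conj
      rwa [conj_conj] at this
    rw [e2, e3, value_cons one_lt_two, value_cons one_lt_two, value_conj one_lt_two (shift N _),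
      ← hP, ← hD] at e1
    simp only [if_true, Bool.false_eq_true, if_false] at e1
    have e5 : (P - (0 + (1 / (2 - 1) - value (shift N (alpha q)) 2)) / 2) / 2 ^ N
        ≤ (P - (1 - D) / 2) / 2 ^ N :=
      div_le_div_of_nonneg_right (by norm_num; linarith) (by positivity)
    linarith
  have hD0 : 0 ≤ D := value_nonneg one_lt_two _
  have hDq : D ≤ 1 / (q - 1) - 1 := by
    have := value_anti hq1 hq2.le (conj (alpha q))
    rwa [value_conj hq1 (alpha q), value_alpha hq1 hq2.le] at this
  have hN1 : N ≠ 1 := by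
    rintro rfl
    exact not_seqLT.2 h.le ⟨0, by simp, by simp [conj_apply, shift_apply, h1], h0⟩
  have hpos := h.pos
  rw [value_zeroOnes hq1]
  have hP0 : 0 ≤ P := value_nonneg one_lt_two _
  -- For `N = 2` the bound `hDq` is too weak near the golden ratio. There `α(q)` starts with `1100`,
  -- so `D ≤ 1/4` and `P ≤ 17/24`, while `q (q - 1) ≤ 1 + 1 / q ^ 2 < 18/13`.
  rcases Nat.lt_or_ge N 3 with hN | hN
  · obtain rfl : N = 2 := by omega
    have hz : ∀ i < 2, alpha q (i + 2) = false := by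
      have hc : ∀ i < 2, conj (shift 2 (alpha q)) i = alpha q i := by
        have hp := h.le.prefixLE 2
        have z0 : alpha q 2 = false := by
          have := hp 0 (by omega) (by simp) h0
          simpa [conj_apply, shift_apply] using this
        have z1 : alpha q 3 = false := by
          have := hp 1 (by omega) (fun j hj => by
            obtain rfl : j = 0 := by omega
            simp [conj_apply, shift_apply, h0, z0]) h1
          simpa [conj_apply, shift_apply] using this
        intro i hi
        interval_cases i <;> simp [conj_apply, shift_apply, h0, h1, z0, z1]
      intro i hi
      have := hc i hi
      rw [conj_apply, shift_apply] at this
      interval_cases i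
      · rw [h0] at this; simpa using this
      · rw [h1] at this; simpa using this
    have hexp : ∀ p : ℝ, 1 < p →
        value (alpha q) p = (1 + (1 + (value (shift 4 (alpha q)) p / p) / p) / p) / p := by
      intro p hp
      rw [value_succ hp, value_shift hp _ 1, value_shift hp _ 2, value_shift hp _ 3, h0, h1,
        hz 0 (by omega), hz 1 (by omega)]
      simp
    have hq4 := hexp q hq1
    have h24 := hexp 2 one_lt_two
    have hs4 := value_shift_alpha_le hq1 hq2.le 4
    have hs2 := value_nonneg one_lt_two (shift 4 (alpha q))
    rw [value_alpha hq1 hq2.le] at hq4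
    have hgold : 13 / 5 < q ^ 2 := by
      have hg := Real.goldenRatio_sq
      have : (8 : ℝ) / 5 < Real.goldenRatio := by
        nlinarith [Real.one_lt_goldenRatio]
      nlinarith
    have hpoly : q ^ 4 ≤ q ^ 3 + q ^ 2 + 1 := by
      field_simp at hq4
      nlinarith
    have hqq : q ^ 2 * (q * (q - 1)) ≤ q ^ 2 * (18 / 13) := by nlinarith
    have hqq' : q * (q - 1) ≤ 18 / 13 := le_of_mul_le_mul_left hqq (by positivity)
    have hD4 : D ≤ 1 / 4 := by linarith
    have hP3 : P ≤ 17 / 24 := by linarith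
    rw [div_div, le_div_iff₀ (by positivity)]
    nlinarith
  · have h2N : (8 : ℝ) ≤ 2 ^ N := by
      calc (8 : ℝ) = 2 ^ 3 := by norm_num
        _ ≤ 2 ^ N := pow_le_pow_right₀ (by norm_num) hN
    have hP3 : P ≤ 1 / 2 + 9 / 14 * D := by
      by_contra hlt
      rw [not_le] at hlt
      have hpp : 0 ≤ P - (1 - D) / 2 := by linarith
      have : (P - (1 - D) / 2) / 2 ^ N ≤ (P - (1 - D) / 2) / 8 :=
        div_le_div_of_nonneg_left hpp (by norm_num) h2N
      linarith
    have hfin : 1 / 2 + 9 / 14 * (1 / (q - 1) - 1) ≤ 1 / (q - 1) / q := by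
      have e : 1 / (q - 1) / q - (1 / 2 + 9 / 14 * (1 / (q - 1) - 1))
          = (2 - q) * (14 - 4 * q) / (28 * q * (q - 1)) := by
        field_simp
        ring
      have : 0 ≤ (2 - q) * (14 - 4 * q) / (28 * q * (q - 1)) :=
        div_nonneg (mul_nonneg (by linarith) (by linarith)) (by positivity)
      linarith
    linarith

theorem exists_isBaseOf {x p q : ℝ} {d : ℕ → Bool} (hp : 1 < p) (hpq : p ≤ q) (hq2 : q ≤ 2)
    (h1 : x ≤ value d p) (h2 : value d q ≤ x) : ∃ s, IsBaseOf x d s ∧ p ≤ s ∧ s ≤ q := by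
  have hc : ContinuousOn (value d) (Set.Icc p q) :=
    (continuousOn_value d).mono fun s hs => hp.trans_le hs.1
  obtain ⟨s, ⟨hs1, hs2⟩, hs⟩ := intermediate_value_Icc' hpq hc ⟨h2, h1⟩
  exact ⟨s, ⟨hp.trans_le hs1, hs2.trans hq2, hs⟩, hs1, hs2⟩

theorem lt_base_of_lt_value {x p q : ℝ} {d : ℕ → Bool} (hd : IsBaseOf x d q)
    (h : x < value d p) : p < q := by
  by_contra hle
  have := value_anti hd.1 (not_lt.1 hle) d
  rw [hd.2.2] at this
  linarith

theorem IsBaseOf.unique {x p q : ℝ} {d : ℕ → Bool} (hp : IsBaseOf x d p) (hq : IsBaseOf x d q)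
    {i : ℕ} (hi : d i = true) : p = q := by
  rcases lt_trichotomy p q with h | h | h
  · have := value_strictAnti hp.1 h hi
    rw [hp.2.2, hq.2.2] at this
    exact absurd this (lt_irrefl _)
  · exact h
  · have := value_strictAnti hq.1 h hi
    rw [hp.2.2, hq.2.2] at this
    exact absurd this (lt_irrefl _)

/-! ### One step of the algorithm -/

/-- The lower bound `q` belongs to the word `w` produced by the algorithm, and no base up to `q`
is univoque for `x`. -/
structure IsLowerBase (x : ℝ) (w : List Bool) (q : ℝ) : Prop where
  base : IsBaseOf x (prepend w zeroOnes) q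
  golden_lt : Real.goldenRatio < q
  lt_two : q < 2
  notMem : ∀ s ≤ q, s ∉ univoqueBases x

namespace IsLowerBase

variable {x q : ℝ} {w : List Bool} {N : ℕ}

theorem one_lt (h : IsLowerBase x w q) : 1 < q := h.base.1

theorem value_eq (h : IsLowerBase x w q) :
    value (prepend w (prepend [true] (conj (alpha q)))) q = x := by
  rw [value_prepend h.one_lt, value_true_conj_alpha h.one_lt h.lt_two.le, ← value_prepend h.one_lt,
    h.base.2.2]

/-- After the block, `x` continues with `0` and a reflected tail `≽ α(q)`. That tail has value at
least one, so replacing both by `1 0^∞` does not increase the value. -/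
theorem value_append_le (h : IsLowerBase x w q) (hN : IsCritical (alpha q) N) :
    value (prepend (w ++ critBlock (alpha q) N) (prepend [true] fun _ => false)) q ≤ x := by
  rw [← h.value_eq, prepend_true_conj hN, ← prepend_append w, value_prepend_le_iff h.one_lt,
    value_cons h.one_lt, value_cons h.one_lt, value_zeros]
  have := one_le_value_of_alpha_le h.one_lt h.lt_two.le hN.le
  refine div_le_div_of_nonneg_right ?_ (by linarith [h.one_lt])
  simpa using this

theorem lt_value_append (h : IsLowerBase x w q) (hN : IsCritical (alpha q) N) :
    x < value (prepend (w ++ critBlock (alpha q) N) zeroOnes) q := by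
  have hq := h.one_lt
  conv_lhs => rw [← h.value_eq]
  rw [prepend_true_conj hN, ← prepend_append w, value_prepend_lt_iff hq, value_cons hq,
    value_zeroOnes hq, value_conj hq]
  have := (infinitelyManyOnes_alpha hq h.lt_two.le).value_shift_pos hq N
  exact div_lt_div_of_pos_right (by simpa using this) (by linarith)

theorem exists_next (h : IsLowerBase x w q) (hN : IsCritical (alpha q) N) :
    ∃ q', IsBaseOf x (prepend (w ++ critBlock (alpha q) N) zeroOnes) q' := by
  have h2 : value zeroOnes 2 = value (prepend [true] fun _ => false) 2 := by
    rw [value_zeroOnes one_lt_two, value_cons one_lt_two, value_zeros]; norm_num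
  obtain ⟨s, hs, -⟩ := exists_isBaseOf h.one_lt h.lt_two.le le_rfl (h.lt_value_append hN).le (by
    rw [value_prepend one_lt_two, h2, ← value_prepend one_lt_two]
    exact (value_anti h.one_lt h.lt_two.le _).trans (h.value_append_le hN))
  exact ⟨s, hs⟩

theorem lt_next (h : IsLowerBase x w q) (hN : IsCritical (alpha q) N) {q' : ℝ}
    (hq' : IsBaseOf x (prepend (w ++ critBlock (alpha q) N) zeroOnes) q') : q < q' :=
  lt_base_of_lt_value hq' (h.lt_value_append hN)

/-- Values decrease with the base, so for bases between `q` and `q'` the continuations `1 0^∞` and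
`0 1^∞` of the new word still enclose `x`. In base `2` they coincide, which excludes `q' = 2`. -/
theorem next (h : IsLowerBase x w q) (hN : IsCritical (alpha q) N) {q' : ℝ}
    (hq' : IsBaseOf x (prepend (w ++ critBlock (alpha q) N) zeroOnes) q') :
    IsLowerBase x (w ++ critBlock (alpha q) N) q' := by
  have hlt := h.lt_next hN hq'
  refine ⟨hq', h.golden_lt.trans hlt, hq'.2.1.lt_of_ne ?_, fun s hs => ?_⟩
  · rintro rfl
    have h2 : value zeroOnes 2 = value (prepend [true] fun _ => false) 2 := by
      rw [value_zeroOnes one_lt_two, value_cons one_lt_two, value_zeros]; norm_num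
    have h3 := hq'.2.2
    rw [value_prepend one_lt_two, h2, ← value_prepend one_lt_two] at h3
    have h4 := value_strictAnti h.one_lt h.lt_two (i := (w ++ critBlock (alpha q) N).length)
      (d := prepend (w ++ critBlock (alpha q) N) (prepend [true] fun _ => false))
      (by have := prepend_add (w ++ critBlock (alpha q) N) (prepend [true] fun _ => false) 0
          rwa [add_zero] at this)
    linarith [h.value_append_le hN]
  · rcases le_or_gt s q with hsq | hqs
    · exact h.notMem s hsq
    · refine notMem_univoqueBases (w := w ++ critBlock (alpha q) N) ?_ ?_
      · exact (value_anti h.one_lt hqs.le _).trans (h.value_append_le hN)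
      · rw [← hq'.2.2]
        exact value_anti (h.one_lt.trans hqs) hs _

theorem exists_upper (h : IsLowerBase x w q) (hN : IsCritical (alpha q) N) :
    ∃ r, IsBaseOf x (prepend w (periodic (critBlock (alpha q) N))) r := by
  have hq := h.one_lt
  obtain ⟨s, hs, -⟩ := exists_isBaseOf (x := x)
    (d := prepend w (periodic (critBlock (alpha q) N))) hq h.lt_two.le le_rfl (by
      rw [← h.base.2.2, value_prepend_le_iff hq]
      exact (value_zeroOnes_lt_periodic hq h.lt_two.le hN (SeqLE.refl _)).le) (by
      rw [← h.base.2.2, value_prepend one_lt_two, value_prepend hq]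
      refine add_le_add (value_anti hq h.lt_two.le _) ?_
      exact div_le_div₀ (value_nonneg hq _) (value_two_periodic_le h.golden_lt h.lt_two hN)
        (by positivity) (pow_le_pow_left₀ (by linarith) h.lt_two.le _))
  exact ⟨s, hs⟩

end IsLowerBase

/-! ### The initial lower bound and the golden ratio -/

theorem value_prepend_replicate {q : ℝ} (hq : 1 < q) (l : ℕ) (d : ℕ → Bool) :
    value (prepend (List.replicate l false) d) q = value d q / q ^ l := by
  rw [value_prepend hq, wordValue]
  have : (prepend (List.replicate l false) fun _ => false) = fun _ => false := by
    funext i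
    simp only [prepend]
    split_ifs with h
    · simp only [List.length_replicate] at h
      simp [List.getD, h]
    · rfl
  rw [this, value_zeros, zero_add, List.length_replicate]

theorem goldenRatio_lt_two : Real.goldenRatio < 2 := by
  have := Real.goldenRatio_sq
  nlinarith [Real.one_lt_goldenRatio]

theorem value_replicate_goldenRatio (l : ℕ) :
    value (prepend (List.replicate l false) zeroOnes) Real.goldenRatio
      = 1 / Real.goldenRatio ^ l := by
  have hg := Real.one_lt_goldenRatio
  rw [value_prepend_replicate hg, value_zeroOnes hg, div_div (1 : ℝ),
    show (Real.goldenRatio - 1) * Real.goldenRatio = 1 by nlinarith [Real.goldenRatio_sq], div_one]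

theorem value_replicate_two (l : ℕ) :
    value (prepend (List.replicate l false) zeroOnes) 2 = 1 / 2 ^ (l + 1) := by
  rw [value_prepend_replicate one_lt_two, value_zeroOnes one_lt_two, pow_succ]
  norm_num
  ring

section initial

variable {x : ℝ} {l : ℕ}

theorem exists_initial (h1 : 1 / Real.goldenRatio ^ (l + 1) ≤ x)
    (h2 : x < 1 / Real.goldenRatio ^ l) :
    ∃ q, IsBaseOf x (prepend (List.replicate l false) zeroOnes) q := by
  obtain ⟨s, hs, -⟩ := exists_isBaseOf (x := x)
    (d := prepend (List.replicate l false) zeroOnes) Real.one_lt_goldenRatio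
    goldenRatio_lt_two.le le_rfl (by rw [value_replicate_goldenRatio]; exact h2.le) (by
      rw [value_replicate_two]
      refine le_trans ?_ h1
      exact div_le_div_of_nonneg_left zero_le_one (by positivity)
        (pow_le_pow_left₀ (by positivity) goldenRatio_lt_two.le _))
  exact ⟨s, hs⟩

theorem isLowerBase_initial (hx0 : 0 < x) (hx1 : x < 1)
    (h1 : 1 / Real.goldenRatio ^ (l + 1) ≤ x) (h2 : x < 1 / Real.goldenRatio ^ l) {q : ℝ}
    (hq : IsBaseOf x (prepend (List.replicate l false) zeroOnes) q) :
    IsLowerBase x (List.replicate l false) q := by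
  refine ⟨hq, lt_base_of_lt_value hq ?_, hq.2.1.lt_of_ne ?_, ?_⟩
  · rw [value_replicate_goldenRatio]; exact h2
  · rintro rfl
    have h3 := hq.2.2
    rw [value_replicate_two] at h3
    have : 1 / (2 : ℝ) ^ (l + 1) < 1 / Real.goldenRatio ^ (l + 1) :=
      div_lt_div_of_pos_left one_pos (by positivity)
        (pow_lt_pow_left₀ goldenRatio_lt_two (by positivity) (by omega))
    linarith
  · intro s hs hsx
    have hs1 := hsx.1
    have hone : ∀ m : ℕ, value (prepend (List.replicate m false)
        (prepend [true] fun _ => false)) s = 1 / s ^ (m + 1) := fun m => by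
      rw [value_prepend_replicate hs1, value_cons hs1, value_zeros, pow_succ', ← div_div]
      simp
    rcases le_or_gt Real.goldenRatio s with hgs | hsg
    · refine notMem_univoqueBases (w := List.replicate l false) ?_ ?_ hsx
      · rw [hone]
        refine le_trans ?_ h1
        exact div_le_div_of_nonneg_left zero_le_one (by positivity)
          (pow_le_pow_left₀ (by positivity) hgs _)
      · rw [← hq.2.2]
        exact value_anti hs1 hs _
    -- Below the golden ratio `s (s - 1) < 1`, so the switch regions after the words `0^n` cover all
    -- of `(0, 1)`.
    · obtain ⟨n, hn, hnx⟩ := exists_nat_pow_near_of_lt_one hx0 hx1.le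
        (inv_pos.2 (by linarith : 0 < s)) (inv_lt_one_of_one_lt₀ hs1)
      rw [inv_pow, ← one_div] at hn hnx
      refine notMem_univoqueBases (w := List.replicate n false) ?_ ?_ hsx
      · rw [hone]; exact hn.le
      · refine hnx.trans ?_
        rw [value_prepend_replicate hs1, value_zeroOnes hs1]
        refine div_le_div_of_nonneg_right ?_ (by positivity)
        rw [div_div, le_div_iff₀ (mul_pos (by linarith) (by linarith))]
        have := Real.goldenRatio_sq
        nlinarith

end initial

/-! ### Finite runs -/

/-- The first steps of a run of the algorithm. -/
structure IsPartialRun (x : ℝ) (k : ℕ) (q : ℕ → ℝ) (n : ℕ → ℕ) (B : ℕ → List Bool) (J : ℕ) :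
    Prop where
  one_le : 1 ≤ k
  lower_x : Real.goldenRatio ^ (-(k : ℤ)) ≤ x
  x_upper : x < Real.goldenRatio ^ (-(k : ℤ) + 1)
  isBase_q : ∀ j ≤ J, IsBaseOf x (prepend (blocks k B j) zeroOnes) (q j)
  isN : ∀ j < J, IsN (q j) (n j)
  block_eq : ∀ j < J, B j = block (q j) (n j)

theorem IsInfiniteRun.isPartialRun {x : ℝ} {k : ℕ} {q : ℕ → ℝ} {n : ℕ → ℕ} {B : ℕ → List Bool}
    {r : ℕ → ℝ} (h : IsInfiniteRun x k q n B r) (J : ℕ) : IsPartialRun x k q n B J :=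
  ⟨h.one_le, h.lower_x, h.x_upper, fun j _ => h.isBase_q j, fun j _ => h.isN j,
    fun j _ => h.block_eq j⟩

theorem blocks_zero (k : ℕ) (B : ℕ → List Bool) : blocks k B 0 = List.replicate (k - 1) false := by
  simp [blocks]

theorem blocks_succ (k : ℕ) (B : ℕ → List Bool) (j : ℕ) :
    blocks k B (j + 1) = blocks k B j ++ B j := by
  simp [blocks, List.range_succ]

theorem goldenRatio_bounds {x : ℝ} {k : ℕ} (hk : 1 ≤ k)
    (h1 : Real.goldenRatio ^ (-(k : ℤ)) ≤ x) (h2 : x < Real.goldenRatio ^ (-(k : ℤ) + 1)) :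
    1 / Real.goldenRatio ^ (k - 1 + 1) ≤ x ∧ x < 1 / Real.goldenRatio ^ (k - 1) := by
  obtain ⟨l, rfl⟩ := Nat.exists_eq_add_of_le' hk
  rw [Nat.add_sub_cancel]
  rw [show (-((l + 1 : ℕ) : ℤ) + 1) = -(l : ℤ) by push_cast; ring] at h2
  rw [zpow_neg, zpow_natCast] at h1 h2
  rw [one_div, one_div]
  exact ⟨h1, h2⟩

namespace IsPartialRun

variable {x : ℝ} {k : ℕ} {q : ℕ → ℝ} {n : ℕ → ℕ} {B : ℕ → List Bool} {J : ℕ}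

theorem block_eq_critBlock (h : IsPartialRun x k q n B J) {j : ℕ} (hj : j < J) :
    IsCritical (alpha (q j)) (n j - 1) ∧ B j = critBlock (alpha (q j)) (n j - 1) := by
  have hb := h.isBase_q j hj.le
  refine ⟨(h.isN j hj).isCritical hb.1 hb.2.1, ?_⟩
  rw [h.block_eq j hj, SmallestBase.block_eq_critBlock ((h.isN j hj).two_le hb.1 hb.2.1)]

theorem isLowerBase (h : IsPartialRun x k q n B J) (hx0 : 0 < x) (hx1 : x < 1) {j : ℕ}
    (hj : j ≤ J) : IsLowerBase x (blocks k B j) (q j) := by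
  induction j with
  | zero =>
    have hb := h.isBase_q 0 hj
    obtain ⟨h1, h2⟩ := goldenRatio_bounds h.one_le h.lower_x h.x_upper
    rw [blocks_zero] at hb ⊢
    exact isLowerBase_initial hx0 hx1 h1 h2 hb
  | succ j ih =>
    have hb := h.isBase_q (j + 1) hj
    obtain ⟨hc, hB⟩ := h.block_eq_critBlock hj
    rw [blocks_succ, hB] at hb ⊢
    exact (ih (by omega)).next hc hb

theorem lt_succ (h : IsPartialRun x k q n B J) (hx0 : 0 < x) (hx1 : x < 1) {j : ℕ}
    (hj : j < J) : q j < q (j + 1) := by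
  have hb := h.isBase_q (j + 1) hj
  obtain ⟨hc, hB⟩ := h.block_eq_critBlock hj
  rw [blocks_succ, hB] at hb
  exact (h.isLowerBase hx0 hx1 hj.le).lt_next hc hb

theorem le_of_le (h : IsPartialRun x k q n B J) (hx0 : 0 < x) (hx1 : x < 1) {i j : ℕ}
    (hij : i ≤ j) (hj : j ≤ J) : q i ≤ q j := by
  induction j, hij using Nat.le_induction with
  | base => exact le_rfl
  | succ j hij ih => exact (ih (by omega)).trans (h.lt_succ hx0 hx1 hj).le

end IsPartialRun

theorem two_le_of_isCritical {a : ℕ → Bool} {N : ℕ} (h : IsCritical a N) (h1 : a 1 = true) :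
    2 ≤ N := by
  have h0 := h.apply_zero
  have hpos := h.pos
  by_contra hlt
  obtain rfl : N = 1 := by omega
  exact not_seqLT.2 h.le ⟨0, by simp, by simp [conj_apply, shift_apply, h1], h0⟩

theorem prepend_critBlock_one {a : ℕ → Bool} {N : ℕ} (h : IsCritical a N) (h1 : a 1 = true)
    (T : ℕ → Bool) : prepend (critBlock a N) T 1 = false := by
  rw [prepend_critBlock (two_le_of_isCritical h h1), prepend_singleton_succ, conj_apply,
    h.apply_zero]
  rfl

/-- Small reflected tails put a base into `𝒱`. -/
theorem mem_setV_of_conj_shift_le {q : ℝ} (hq : 1 < q) (hq2 : q ≤ 2)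
    (h : ∀ n, SeqLE (conj (shift n (alpha q))) (alpha q)) : q ∈ setV := by
  refine ⟨hq, hq2, fun n => ⟨?_, shift_alpha_le hq hq2 n⟩⟩
  have := (h n).conj
  rwa [conj_conj] at this

namespace IsPartialRun

variable {x : ℝ} {k : ℕ} {q : ℕ → ℝ} {n : ℕ → ℕ} {B : ℕ → List Bool} {J : ℕ}

/-- A finite run can be closed with the reflection of a sequence that approximates the expansion
of one in the last base. -/
theorem lexUnivoque (h : IsPartialRun x k q n B J) (hx0 : 0 < x) (hx1 : x < 1) {c : ℕ → Bool}
    {M : ℕ} (hM : ∀ i < J, n i ≤ M) (hM0 : 0 < M) (hc : ∀ i < M, c i = alpha (q J) i)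
    (huniv : LexUnivoque (alpha (q J)) (prepend [true] (conj c))) :
    LexUnivoque (alpha (q J)) (prepend (blocks k B J) (prepend [true] (conj c))) := by
  have hbase : ∀ i, IsLowerBase x (blocks k B (min i J)) (q (min i J)) := fun i =>
    h.isLowerBase hx0 hx1 (min_le_right _ _)
  have hle : ∀ i j, i ≤ j → SeqLE (alpha (q (min i J))) (alpha (q (min j J))) := fun i j hij =>
    alpha_le_alpha (hbase i).one_lt (h.le_of_le hx0 hx1 (min_le_min_right J hij)
      (min_le_right _ _)) (hbase j).lt_two.le
  have hleJ : ∀ i, SeqLE (alpha (q (min i J))) (alpha (q J)) := fun i => by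
    have := hle (min i J) J (min_le_right _ _)
    rwa [min_assoc, min_self] at this
  have hα1 : ∀ i, alpha (q (min i J)) 1 = true := fun i =>
    alpha_one (hbase i).golden_lt (hbase i).lt_two.le
  have hJ1 : alpha (q J) 1 = true := by simpa using hα1 J
  have hJ0 : alpha (q J) 0 = true := by
    simpa using alpha_zero (hbase J).one_lt (hbase J).lt_two.le
  set S := prepend [true] (conj c) with hS
  set T : ℕ → ℕ → Bool := fun i => prepend ((List.range' i (J - i)).map B).flatten S with hT
  have hstep : ∀ i < J, T i = prepend (B i) (T (i + 1)) := fun i hi => by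
    simp only [hT]
    rw [show J - i = (J - (i + 1)) + 1 by omega, List.range'_succ, List.map_cons,
      List.flatten_cons, prepend_append]
  have hend : ∀ i, J ≤ i → T i = S := fun i hi => by
    simp [hT, Nat.sub_eq_zero_of_le hi, prepend_nil]
  have hstep' : ∀ i < J, IsCritical (alpha (q i)) (n i - 1) ∧
      T i = prepend (critBlock (alpha (q i)) (n i - 1)) (T (i + 1)) := fun i hi => by
    obtain ⟨h1, h2⟩ := h.block_eq_critBlock hi
    exact ⟨h1, by rw [hstep i hi, h2]⟩
  -- The data are frozen from step `J` on, and length `0` marks the closing sequence `S`.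
  have hfam : BlockFamily (alpha (q J)) (fun i => alpha (q (min i J)))
      (fun i => if i < J then n i - 1 else 0) T := by
    refine ⟨hle, hleJ, fun i => ?_, fun i => ?_⟩
    · rcases Nat.lt_or_ge i J with hi | hi
      · obtain ⟨h1, h2⟩ := hstep' i hi
        rw [h2, prepend_critBlock h1.pos, prepend_true_zero]
      · rw [hend i hi, hS, prepend_true_zero]
    · rcases Nat.lt_or_ge i J with hi | hi
      · left
        simp only [hi, if_true, min_eq_left hi.le]
        exact hstep' i hi
      · right
        rw [hend i hi]
        refine ⟨by simp [not_lt.2 hi], huniv, fun j _ => ?_⟩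
        by_cases hjJ : j < J
        · simp only [hjJ, if_true]
          refine ((prepend_true_le (hleJ j).conj).prefixLE _).congr_left fun i hi => ?_
          cases i with
          | zero => rw [hS, prepend_true_zero, prepend_true_zero]
          | succ i =>
            rw [hS, prepend_singleton_succ, prepend_singleton_succ, conj_apply, conj_apply,
              hc i (by have := hM j hjJ; omega)]
        · simp only [hjJ, if_false]
          intro s hs
          omega
  have hblocks : blocks k B J = List.replicate (k - 1) false ++
      ((List.range' 0 (J - 0)).map B).flatten := by
    rw [blocks, Nat.sub_zero, List.range_eq_range']
  rw [hblocks, prepend_append]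
  refine hfam.lexUnivoque_replicate hJ0 hJ1 ?_ (k - 1)
  rcases Nat.eq_zero_or_pos J with hJ | hJ
  · rw [hend 0 (by omega), hS, prepend_singleton_succ, conj_apply, hc 0 hM0, hJ0]
    rfl
  · obtain ⟨h1, h2⟩ := hstep' 0 hJ
    rw [h2]
    exact prepend_critBlock_one h1 (by simpa using hα1 0) _

/-- Replace `α(q_J)` by `c = (v v̄)^∞` for a long reflection-free prefix `v`. Since `c` has value at
most one in base `q_J`, the resulting sequence has value at least `x` there. It closely approximates
a sequence of value less than `x` at `t`, so it represents `x` in a base between `q_J` and `t`. -/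
theorem exists_univoque_lt (h : IsPartialRun x k q n B J) (hx0 : 0 < x) (hx1 : x < 1)
    (hc : ∀ n, SeqLT (conj (shift n (alpha (q J)))) (alpha (q J))) {b : ℝ} (hb : q J < b) :
    ∃ s ∈ univoqueBases x, s < b := by
  have hJ := h.isLowerBase hx0 hx1 le_rfl
  have hq := hJ.one_lt
  have hq2 := hJ.lt_two.le
  obtain ⟨t, hqt, htb⟩ := exists_between (lt_min hb hJ.lt_two)
  obtain ⟨htb, ht2⟩ := lt_min_iff.1 htb
  have ht := hq.trans hqt
  set e := prepend (blocks k B J) (prepend [true] (conj (alpha (q J)))) with he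
  have hgap : 0 < x - value e t := by
    have hdig : e (blocks k B J).length = true := by
      have := prepend_add (blocks k B J) (prepend [true] (conj (alpha (q J)))) 0
      rwa [add_zero] at this
    have := value_strictAnti hq hqt hdig
    rw [he, hJ.value_eq] at this
    linarith
  have hlim : Filter.Tendsto (fun m : ℕ => 1 / (t - 1) / t ^ m) Filter.atTop (nhds 0) := by
    simpa using (tendsto_pow_atTop_atTop_of_one_lt ht).const_div_atTop (1 / (t - 1))
  obtain ⟨m, hm⟩ := Filter.eventually_atTop.1 (hlim.eventually (gt_mem_nhds hgap))
  -- The sum serves as a common bound of all `n i`, and `m` makes the truncation error smaller than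
  -- the gap at `t`.
  obtain ⟨M, hMle, hfree⟩ := exists_isReflectionFree (shift_alpha_le hq hq2) hc
    (m + 1 + ∑ i ∈ Finset.range J, n i)
  have hM0 : 0 < M := by omega
  have hMn : ∀ i < J, n i ≤ M := fun i hi => by
    have := Finset.single_le_sum (f := n) (fun _ _ => Nat.zero_le _) (Finset.mem_range.2 hi)
    omega
  set c := reflectPeriodic (alpha (q J)) M with hcdef
  have hcM : ∀ i < M, c i = alpha (q J) i := fun i hi => reflectPeriodic_of_lt hi
  have huniv := h.lexUnivoque hx0 hx1 hMn hM0 hcM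
    (lexUnivoque_reflectPeriodic hM0 (shift_alpha_le hq hq2) hc hfree)
  set d := prepend (blocks k B J) (prepend [true] (conj c)) with hd
  have hdt : value d t < x := by
    have hag : ∀ j < M, d j = e j := fun j hj => by
      rcases Nat.lt_or_ge j (blocks k B J).length with hjl | hjl
      · rw [hd, he, prepend_lt hjl, prepend_lt hjl]
      · obtain ⟨u, rfl⟩ := Nat.exists_eq_add_of_le hjl
        rw [hd, he, prepend_add, prepend_add]
        cases u with
        | zero => rw [prepend_true_zero, prepend_true_zero]
        | succ u =>
          rw [prepend_singleton_succ, prepend_singleton_succ, conj_apply, conj_apply,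
            hcM u (by omega)]
    have h1 := (le_abs_self _).trans (abs_value_sub_le ht hag)
    have h2 := hm M (by omega)
    linarith
  have hdq : x ≤ value d (q J) := by
    rw [← hJ.value_eq, value_prepend_le_iff hq, value_cons hq, value_cons hq, value_conj hq,
      value_conj hq]
    have hsh := shift_reflectPeriodic_lt hM0 (shift_alpha_le hq hq2) hc hfree
    have h1 : value c (q J) ≤ 1 := value_le_one hq hq2 (hsh 0).1.le fun n _ => (hsh (n + 1)).1.le
    rw [value_alpha hq hq2]
    refine div_le_div_of_nonneg_right ?_ (by linarith)
    linarith
  obtain ⟨s, hs, hqs, hst⟩ := exists_isBaseOf hq hqt.le ht2.le hdq hdt.le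
  exact ⟨s, (huniv.mono (alpha_le_alpha hq hqs hs.2.1)).mem_univoqueBases hs.1 hs.2.1 hs.2.2,
    hst.trans_lt htb⟩

/-- If all reflected tails in the last base are strictly small, then this base is the smallest
univoque base. -/
theorem qs_mem_setV (h : IsPartialRun x k q n B J) (hx0 : 0 < x) (hx1 : x < 1)
    (hc : ∀ n, SeqLT (conj (shift n (alpha (q J)))) (alpha (q J))) : qs x ∈ setV := by
  have hJ := h.isLowerBase hx0 hx1 le_rfl
  have heq : qs x = q J := by
    obtain ⟨s, hs, -⟩ := h.exists_univoque_lt hx0 hx1 hc (lt_add_one (q J))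
    refine csInf_eq_of_forall_ge_of_forall_gt_exists_lt ⟨s, hs⟩ (fun a ha => ?_)
      fun b hb => h.exists_univoque_lt hx0 hx1 hc hb
    by_contra hlt
    exact hJ.notMem a (not_le.1 hlt).le ha
  rw [heq]
  exact mem_setV_of_conj_shift_le hJ.one_lt hJ.lt_two.le fun n => (hc n).le

end IsPartialRun

/-! ### Infinite runs and their limit -/

/-- The infinite concatenation `B i B (i + 1) B (i + 2) …` of nonempty words. -/
def infConcat (B : ℕ → List Bool) (i m : ℕ) : Bool :=
  -- For nonempty words `max 1` changes nothing; it secures termination.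
  if m < max 1 (B i).length then (B i).getD m false
  else infConcat B (i + 1) (m - max 1 (B i).length)
termination_by m
decreasing_by omega

theorem infConcat_eq {B : ℕ → List Bool} {i : ℕ} (h : B i ≠ []) :
    infConcat B i = prepend (B i) (infConcat B (i + 1)) := by
  have hl : max 1 (B i).length = (B i).length := max_eq_right (List.length_pos_of_ne_nil h)
  funext m
  rw [infConcat, hl, prepend]

namespace IsInfiniteRun

variable {x : ℝ} {k : ℕ} {q : ℕ → ℝ} {n : ℕ → ℕ} {B : ℕ → List Bool} {r : ℕ → ℝ}

theorem critical (h : IsInfiniteRun x k q n B r) (j : ℕ) :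
    IsCritical (alpha (q j)) (n j - 1) ∧ B j = critBlock (alpha (q j)) (n j - 1) :=
  (h.isPartialRun (j + 1)).block_eq_critBlock (Nat.lt_succ_self j)

theorem ne_nil (h : IsInfiniteRun x k q n B r) (j : ℕ) : B j ≠ [] := by
  rw [(h.critical j).2]
  exact critBlock_ne_nil (h.critical j).1

theorem isLowerBase (h : IsInfiniteRun x k q n B r) (hx0 : 0 < x) (hx1 : x < 1) (j : ℕ) :
    IsLowerBase x (blocks k B j) (q j) :=
  (h.isPartialRun j).isLowerBase hx0 hx1 le_rfl

theorem strictMono (h : IsInfiniteRun x k q n B r) (hx0 : 0 < x) (hx1 : x < 1) : StrictMono q :=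
  strictMono_nat_of_lt_succ fun j => (h.isPartialRun (j + 1)).lt_succ hx0 hx1 (Nat.lt_succ_self j)

theorem le_length_blocks (h : IsInfiniteRun x k q n B r) (j : ℕ) :
    j ≤ (blocks k B j).length := by
  induction j with
  | zero => exact Nat.zero_le _
  | succ j ih =>
    rw [blocks_succ, List.length_append]
    have := List.length_pos_of_ne_nil (h.ne_nil j)
    omega

theorem prepend_blocks (h : IsInfiniteRun x k q n B r) (j : ℕ) :
    prepend (blocks k B j) (infConcat B j) = prepend (blocks k B 0) (infConcat B 0) := by
  induction j with
  | zero => rfl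
  | succ j ih => rw [← ih, blocks_succ, prepend_append, ← infConcat_eq (h.ne_nil j)]

/-- The lower bounds of an infinite run converge to the smallest univoque base, and the
concatenation of all blocks is the unique expansion in this base. -/
theorem exists_limit (h : IsInfiniteRun x k q n B r) (hx0 : 0 < x) (hx1 : x < 1) :
    ∃ p, qs x = p ∧ 1 < p ∧ p ≤ 2 ∧ (∀ j, q j < p) ∧ Filter.Tendsto q Filter.atTop (nhds p) ∧
      ∀ j, value (prepend (blocks k B j) (infConcat B j)) p = x := by
  have hbase := h.isLowerBase hx0 hx1
  have hmono := h.strictMono hx0 hx1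
  have hbdd : BddAbove (Set.range q) := ⟨2, by rintro _ ⟨j, rfl⟩; exact (hbase j).lt_two.le⟩
  have htend := tendsto_atTop_ciSup hmono.monotone hbdd
  have hle : ∀ j, q j ≤ ⨆ j, q j := le_ciSup hbdd
  have hp2 : ⨆ j, q j ≤ 2 := ciSup_le fun j => (hbase j).lt_two.le
  generalize (⨆ j, q j) = p at htend hle hp2
  have hlt : ∀ j, q j < p := fun j => (hmono (Nat.lt_succ_self j)).trans_le (hle _)
  have hp := (hbase 0).one_lt.trans (hlt 0)
  set d := prepend (blocks k B 0) (infConcat B 0) with hd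
  have hval : value d p = x := by
    have h1 : Filter.Tendsto (fun j => value d (q j)) Filter.atTop (nhds (value d p)) :=
      (continuousAt_value hp d).tendsto.comp htend
    -- In base `q j` the number `x` is the value of the word after `j` steps followed by `0 1^∞`.
    -- This shares at least `j` digits with `d`.
    have h2 : Filter.Tendsto (fun j => value d (q j) - x) Filter.atTop (nhds 0) := by
      refine squeeze_zero_norm (a := fun j : ℕ => 1 / (q 0 - 1) / q 0 ^ j) (fun j => ?_) ?_
      · have hq0 := (hbase 0).one_lt
        have hqj := (hbase j).one_lt
        have h0j := hmono.monotone (Nat.zero_le j)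
        have h3 := abs_value_sub_le hqj (d := d) (e := prepend (blocks k B j) zeroOnes)
          (n := (blocks k B j).length) (fun i hi => by
            rw [hd, ← h.prepend_blocks j, prepend_lt hi, prepend_lt hi])
        rw [(hbase j).base.2.2] at h3
        refine h3.trans (div_le_div₀ (by positivity) ?_ (by positivity) ?_)
        · exact div_le_div_of_nonneg_left zero_le_one (by linarith) (by linarith)
        · exact (pow_le_pow_right₀ hq0.le (h.le_length_blocks j)).trans
            (pow_le_pow_left₀ (by linarith) h0j _)
      · simpa using (tendsto_pow_atTop_atTop_of_one_lt (hbase 0).one_lt).const_div_atTop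
          (1 / (q 0 - 1))
    have h3 := tendsto_nhds_unique (h1.sub_const x) h2
    linarith
  have hfam : BlockFamily (alpha p) (fun i => alpha (q i)) (fun i => n i - 1) (infConcat B) := by
    have hstep : ∀ i, infConcat B i
        = prepend (critBlock (alpha (q i)) (n i - 1)) (infConcat B (i + 1)) := fun i => by
      rw [← (h.critical i).2, ← infConcat_eq (h.ne_nil i)]
    refine ⟨fun i j hij => alpha_le_alpha (hbase i).one_lt (hmono.monotone hij)
      (hbase j).lt_two.le, fun i => alpha_le_alpha (hbase i).one_lt (hle i) hp2, fun i => ?_,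
      fun i => Or.inl ⟨(h.critical i).1, hstep i⟩⟩
    rw [hstep, prepend_critBlock (h.critical i).1.pos, prepend_true_zero]
  have huniv : LexUnivoque (alpha p) d := by
    rw [hd, blocks_zero]
    refine hfam.lexUnivoque_replicate (alpha_zero hp hp2)
      (alpha_one ((hbase 0).golden_lt.trans (hlt 0)) hp2) ?_ _
    rw [infConcat_eq (h.ne_nil 0), (h.critical 0).2]
    exact prepend_critBlock_one (h.critical 0).1
      (alpha_one (hbase 0).golden_lt (hbase 0).lt_two.le) _
  have hleast : IsLeast (univoqueBases x) p := by
    refine ⟨huniv.mem_univoqueBases hp hp2 hval, fun s hs => ?_⟩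
    refine le_of_tendsto' htend fun j => ?_
    by_contra hlt'
    exact (hbase j).notMem s (not_le.1 hlt').le hs
  exact ⟨p, hleast.csInf_eq, hp, hp2, hlt, htend, fun j => by rw [h.prepend_blocks j, hval]⟩

/-- If the blocks are constant from some step on, then the upper bound is the limit. -/
theorem upper_eq_of_constant (h : IsInfiniteRun x k q n B r) {p : ℝ} (hp : 1 < p) (hp2 : p ≤ 2)
    {j : ℕ} (hval : value (prepend (blocks k B j) (infConcat B j)) p = x)
    (hB : ∀ i ≥ j, B i = B j) : r j = p := by
  have hper : infConcat B j = periodic (B j) := by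
    refine eq_periodic_of_prepend (h.ne_nil j) (T := fun i => infConcat B (j + i)) (fun i => ?_) 0
    rw [infConcat_eq (h.ne_nil _), hB (j + i) (by omega), add_assoc]
  rw [hper] at hval
  have hzero : periodic (B j) 0 = true := by
    rw [(h.critical j).2]; exact periodic_critBlock_zero (h.critical j).1
  refine (h.isBase_r j).unique ⟨hp, hp2, hval⟩ (i := (blocks k B j).length) ?_
  have := prepend_add (blocks k B j) (periodic (B j)) 0
  rw [add_zero] at this
  rw [this, hzero]

end IsInfiniteRun

/-! ### The finiteness condition and membership in `𝒱` -/

theorem critBlock_congr {a b : ℕ → Bool} {N : ℕ} (h : ∀ i < N, a i = b i) :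
    critBlock a N = critBlock b N := by
  refine List.map_congr_left fun t ht => ?_
  have ht := List.mem_range.1 ht
  cases t with
  | zero => rw [prepend_true_zero, prepend_true_zero]
  | succ t =>
    rw [prepend_singleton_succ, prepend_singleton_succ, conj_apply, conj_apply, h t (by omega)]

theorem length_segment (a : ℕ → Bool) (i j : ℕ) : (segment a i j).length = j + 1 - i := by
  simp [segment]

theorem segment_getD {a : ℕ → Bool} {i j t : ℕ} (ht : t < j + 1 - i) :
    (segment a i j).getD t false = a (i - 1 + t) := by
  simp [segment, List.getD, ht]

theorem segment_one_eq_iff {a b : ℕ → Bool} {m : ℕ} :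
    segment a 1 m = segment b 1 m ↔ ∀ i < m, a i = b i := by
  constructor
  · intro h i hi
    have := congrArg (fun l => l.getD i false) h
    simp only [segment_getD (show i < m + 1 - 1 by omega)] at this
    simpa using this
  · intro h
    refine List.map_congr_left fun t ht => ?_
    have ht := List.mem_range.1 ht
    rw [h _ (by omega)]

theorem wordLT_segment_iff {a : ℕ → Bool} {m n : ℕ} (hm : n < m) :
    WordLT (segment a 1 (m - n + 1)) (segment (conj a) n m) ↔
      ∃ t < m - n + 1, (∀ s < t, a s = conj (shift (n - 1) a) s) ∧ a t = false ∧
        conj (shift (n - 1) a) t = true := by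
  have e1 : ∀ t < m - n + 1,
      prepend (segment a 1 (m - n + 1)) (fun _ => false) t = a t := fun t ht => by
    rw [prepend_lt (by rw [length_segment]; omega), segment_getD (by omega)]
    congr 1; omega
  have e2 : ∀ t < m - n + 1, prepend (segment (conj a) n m) (fun _ => false) t
      = conj (shift (n - 1) a) t := fun t ht => by
    rw [prepend_lt (by rw [length_segment]; omega), segment_getD (by omega), conj_apply,
      conj_apply, shift_apply, add_comm]
  constructor
  · rintro ⟨t, hs, h0, h1⟩
    have ht : t < m - n + 1 := by
      by_contra hge
      simp [prepend, length_segment, show ¬ t < m + 1 - n by omega] at h1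
    refine ⟨t, ht, fun s hst => ?_, ?_, ?_⟩
    · rw [← e1 s (by omega), ← e2 s (by omega), hs s hst]
    · rw [← e1 t ht, h0]
    · rw [← e2 t ht, h1]
  · rintro ⟨t, ht, hs, h0, h1⟩
    refine ⟨t, fun s hst => ?_, ?_, ?_⟩
    · rw [e1 s (by omega), e2 s (by omega), hs s hst]
    · rw [e1 t ht, h0]
    · rw [e2 t ht, h1]

theorem agree_of_le_of_le {a b c : ℕ → Bool} {m : ℕ} (hab : SeqLE a b) (hbc : SeqLE b c)
    (hac : ∀ i < m, a i = c i) : ∀ i < m, b i = a i := by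
  intro i
  induction i using Nat.strong_induction_on with
  | _ i ih =>
    intro hi
    have hlow : ∀ j < i, b j = a j := fun j hj => ih j hj (hj.trans hi)
    have h1 := hab.prefixLE m i hi (fun j hj => (hlow j hj).symm)
    have h2 := hbc.prefixLE m i hi (fun j hj => (hlow j hj).trans (hac j (hj.trans hi)))
    rw [← hac i hi] at h2
    cases ha : a i <;> cases hb : b i <;> simp_all

namespace IsInfiniteRun

variable {x : ℝ} {k : ℕ} {q : ℕ → ℝ} {n : ℕ → ℕ} {B : ℕ → List Bool} {r : ℕ → ℝ}

/-- By monotonicity of `α`, agreement at both ends fixes the first `m` digits on `[q_j, r_j]`, hence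
also the critical shift and the block. All later lower bounds stay in this interval, so the block
repeats and the limit is `r_j`. -/
theorem notMem_setV_of_finiteCondition (h : IsInfiniteRun x k q n B r) (hx0 : 0 < x) (hx1 : x < 1)
    {j : ℕ} (hfin : FiniteCondition (q j) (n j) (r j)) : qs x ∉ setV := by
  obtain ⟨p, hqs, hp, hp2, hlt, -, hval⟩ := h.exists_limit hx0 hx1
  have hbase := h.isLowerBase hx0 hx1
  have hmono := h.strictMono hx0 hx1
  obtain ⟨m, ⟨⟨hnm, hword⟩, -⟩, hseg⟩ := hfin
  have hn2 := (h.isN j).two_le (hbase j).one_lt (hbase j).lt_two.le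
  rw [wordLT_segment_iff hnm] at hword
  obtain ⟨t, htm, hts, ht0, ht1⟩ := hword
  rw [segment_one_eq_iff] at hseg
  obtain ⟨hcrit, hBj⟩ := h.critical j
  obtain ⟨N, hN⟩ : ∃ N, n j = N + 1 := ⟨n j - 1, by omega⟩
  rw [hN, Nat.add_sub_cancel] at hcrit hBj hts ht1
  have hr := h.isBase_r j
  have hqj := (hbase j).one_lt
  have hagree : ∀ s, q j ≤ s → s ≤ r j → ∀ i < m, alpha s i = alpha (q j) i := fun s hs hsr =>
    agree_of_le_of_le (alpha_le_alpha hqj hs (hsr.trans hr.2.1))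
      (alpha_le_alpha (hqj.trans_le hs) hsr hr.2.1) hseg
  have hlts : ∀ s, q j ≤ s → s ≤ r j → SeqLT (alpha s) (conj (shift N (alpha s))) := by
    intro s hs hsr
    refine seqLT_of_agree hts ht0 ht1 (fun i hi => hagree s hs hsr i (by omega)) fun i hi => ?_
    rw [conj_apply, conj_apply, shift_apply, shift_apply, hagree s hs hsr _ (by omega)]
  have hcrits : ∀ s, q j ≤ s → s ≤ r j → IsCritical (alpha s) N := by
    intro s hs hsr
    refine ⟨shift_alpha_le (hqj.trans_le hs) (hsr.trans hr.2.1), hcrit.pos, (hlts s hs hsr).le,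
      fun M hM => ?_⟩
    rw [← not_seqLE]
    intro hle
    obtain ⟨i, hi, hne⟩ := hcrit.exists_ne hM (alpha_le_alpha hqj hs (hsr.trans hr.2.1)) hle
    exact hne (hagree s hs hsr i (by omega)).symm
  have hqr : q j < r j := lt_base_of_lt_value hr (by
    conv_lhs => rw [← (hbase j).base.2.2]
    rw [value_prepend_lt_iff hqj, hBj]
    exact value_zeroOnes_lt_periodic hqj (hbase j).lt_two.le hcrit (SeqLE.refl _))
  -- In base `r j` the periodic continuation is worth more than `0 1^∞`, so `0 1^∞` can reach the
  -- value `x` only in a smaller base.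
  have hupper : ∀ i, IsBaseOf x (prepend (blocks k B i) (periodic (B j))) (r j) →
      q i ≤ r j := by
    intro i hb
    by_contra hgt
    rw [not_le] at hgt
    have h1 := value_anti hr.1 hgt.le (prepend (blocks k B i) zeroOnes)
    rw [(hbase i).base.2.2, ← hb.2.2, value_prepend_le_iff hr.1, hBj] at h1
    exact not_lt.2 h1 (value_zeroOnes_lt_periodic hr.1 hr.2.1 hcrit
      (alpha_le_alpha hqj hqr.le hr.2.1))
  have hblock : ∀ i ≥ j, q i ≤ r j → B i = B j := by
    intro i hij hi
    have hs := hmono.monotone hij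
    have hni : n i = N + 1 := (h.isN i).unique (hcrits _ hs hi).isN
    rw [(h.critical i).2, hBj, hni, Nat.add_sub_cancel]
    have hNm : N ≤ m := by omega
    exact critBlock_congr fun l hl => hagree _ hs hi l (by omega)
  have hind : ∀ i ≥ j, IsBaseOf x (prepend (blocks k B i) (periodic (B j))) (r j) := by
    intro i hij
    induction i, hij using Nat.le_induction with
    | base => exact hr
    | succ i hij ih =>
      rwa [blocks_succ, prepend_append, hblock i hij (hupper i ih),
        prepend_periodic (h.ne_nil j)]
  have hrp := h.upper_eq_of_constant hp hp2 (hval j) fun i hij =>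
    hblock i hij (hupper i (hind i hij))
  rw [hqs, ← hrp]
  rintro ⟨-, -, hV⟩
  have h1 := (hlts _ hqr.le le_rfl).conj
  rw [conj_conj] at h1
  exact not_seqLT.2 (hV N).1 h1

theorem finiteCondition_of_notMem_setV (h : IsInfiniteRun x k q n B r) (hx0 : 0 < x)
    (hx1 : x < 1) (hV : qs x ∉ setV) : ∃ j, FiniteCondition (q j) (n j) (r j) := by
  obtain ⟨p, hqs, hp, hp2, hlt, htend, hval⟩ := h.exists_limit hx0 hx1
  have hbase := h.isLowerBase hx0 hx1
  rw [hqs] at hV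
  obtain ⟨N, hN⟩ : ∃ N, IsCritical (alpha p) N := by
    by_contra hno
    refine hV (mem_setV_of_conj_shift_le hp hp2 fun l => ?_)
    by_contra hl
    rw [not_seqLE] at hl
    obtain ⟨l', hl'⟩ := exists_isN hl.le
    exact hno ⟨_, hl'.isCritical hp hp2⟩
  obtain ⟨t, hts, ht0, ht1⟩ : SeqLT (alpha p) (conj (shift N (alpha p))) := by
    -- If equality held, the reflected tails from `N` on would be tails of `α(p)` itself, and `p`
    -- would belong to `𝒱`.
    refine hN.le.resolve_right fun heq => hV (mem_setV_of_conj_shift_le hp hp2 fun l => ?_)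
    rcases Nat.lt_or_ge l N with hl | hl
    · exact (hN.lt l hl).le
    · obtain ⟨u, rfl⟩ := Nat.exists_eq_add_of_le' hl
      rw [← shift_shift, conj_shift, ← heq]
      exact hN.shift_le u
  have hfirst : ∀ M, ∃ i, M < N → (∀ s < i, conj (shift M (alpha p)) s = alpha p s) ∧
      conj (shift M (alpha p)) i = false ∧ alpha p i = true := fun M => by
    by_cases hM : M < N
    · obtain ⟨i, hi⟩ := hN.lt M hM
      exact ⟨i, fun _ => hi⟩
    · exact ⟨0, fun hM' => absurd hM' hM⟩
  choose f hf using hfirst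
  -- The first `L` digits contain all the finitely many comparisons that make `N` critical,
  -- including the strict one at `t`.
  set L := N + t + 1 + ∑ M ∈ Finset.range N, (M + f M + 1) with hL
  have hfL : ∀ M < N, M + f M + 1 ≤ L := fun M hM => by
    have := Finset.single_le_sum (f := fun M => M + f M + 1) (fun _ _ => Nat.zero_le _)
      (Finset.mem_range.2 hM)
    omega
  obtain ⟨p₀, -, hp₀p, hp₀⟩ := exists_lt_alpha_agree hp hp2 L
  obtain ⟨j, hj⟩ := Filter.eventually_atTop.1 (htend.eventually (lt_mem_nhds hp₀p))
  have hagree : ∀ i ≥ j, ∀ l < L, alpha (q i) l = alpha p l := fun i hi =>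
    hp₀ _ (hj i hi) (hlt i).le
  have hcrit : ∀ i ≥ j, IsCritical (alpha (q i)) N := by
    intro i hi
    refine ⟨shift_alpha_le (hbase i).one_lt (hbase i).lt_two.le, hN.pos, ?_, fun M hM => ?_⟩
    · refine (seqLT_of_agree hts ht0 ht1 (fun l hl => hagree i hi l (by omega))
        fun l hl => ?_).le
      rw [conj_apply, conj_apply, shift_apply, shift_apply, hagree i hi _ (by omega)]
    · obtain ⟨h1, h2, h3⟩ := hf M hM
      have hML := hfL M hM
      refine seqLT_of_agree h1 h2 h3 (fun l hl => ?_) fun l hl => hagree i hi l (by omega)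
      rw [conj_apply, conj_apply, shift_apply, shift_apply, hagree i hi _ (by omega)]
  have hni : ∀ i ≥ j, n i = N + 1 := fun i hi => (h.isN i).unique (hcrit i hi).isN
  have hB : ∀ i ≥ j, B i = B j := by
    intro i hi
    rw [(h.critical i).2, (h.critical j).2, hni i hi, hni j le_rfl, Nat.add_sub_cancel]
    exact critBlock_congr fun l hl => by
      rw [hagree i hi l (by omega), hagree j le_rfl l (by omega)]
  have hrp := h.upper_eq_of_constant hp hp2 (hval j) hB
  have hmem : N + 1 < N + 1 + t ∧ WordLT (segment (alpha (q j)) 1 (N + 1 + t - (N + 1) + 1))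
      (segment (conj (alpha (q j))) (N + 1) (N + 1 + t)) := by
    have ht : t ≠ 0 := by
      rintro rfl
      rw [hN.apply_zero] at ht0
      simp at ht0
    refine ⟨by omega, (wordLT_segment_iff (by omega)).2 ⟨t, by omega, fun s hs => ?_, ?_, ?_⟩⟩
    · rw [hagree j le_rfl s (by omega), hts s hs, Nat.add_sub_cancel, conj_apply, conj_apply,
        shift_apply, shift_apply, hagree j le_rfl _ (by omega)]
    · rw [hagree j le_rfl t (by omega), ht0]
    · rw [← ht1, Nat.add_sub_cancel, conj_apply, conj_apply, shift_apply, shift_apply,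
        hagree j le_rfl _ (by omega)]
  classical
  have hex : ∃ m, N + 1 < m ∧ WordLT (segment (alpha (q j)) 1 (m - (N + 1) + 1))
      (segment (conj (alpha (q j))) (N + 1) m) := ⟨_, hmem⟩
  have hmin := Nat.find_min' hex hmem
  refine ⟨j, Nat.find hex, ?_, ?_⟩
  · rw [hni j le_rfl]
    exact ⟨Nat.find_spec hex, fun m hm => Nat.find_min' hex hm⟩
  · rw [segment_one_eq_iff, hrp]
    exact fun i hi => hagree j le_rfl i (by omega)

end IsInfiniteRun

/-! ### Existence of the run -/

/-- The lower bound computed by the algorithm from the word `w`. -/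
noncomputable def runBase (x : ℝ) (w : List Bool) : ℝ :=
  Classical.epsilon (IsBaseOf x (prepend w zeroOnes))

/-- The index computed by the algorithm from the word `w`. -/
noncomputable def runIndex (x : ℝ) (w : List Bool) : ℕ :=
  Classical.epsilon (IsN (runBase x w))

/-- The word after `j` steps of the algorithm. -/
noncomputable def runWord (x : ℝ) (k : ℕ) : ℕ → List Bool
  | 0 => List.replicate (k - 1) false
  | j + 1 => runWord x k j ++ block (runBase x (runWord x k j)) (runIndex x (runWord x k j))

theorem blocks_runWord (x : ℝ) (k j : ℕ) :
    blocks k (fun j => block (runBase x (runWord x k j)) (runIndex x (runWord x k j))) j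
      = runWord x k j := by
  induction j with
  | zero => rw [blocks_zero, runWord]
  | succ j ih => rw [blocks_succ, ih, runWord]

/-- A step without an index would put `q_s(x)` into `𝒱`. The index found at each step exhibits a
reflected tail that no base below `2` in the closure of `𝒰` admits, so the algorithm does not stop.
-/
theorem exists_isInfiniteRun {x : ℝ} (hx0 : 0 < x) (hx1 : x < 1) (hV : qs x ∉ setV) :
    ∃ k q n B r, IsInfiniteRun x k q n B r := by
  obtain ⟨z, hz1, hz2⟩ := exists_mem_Ico_zpow hx0 Real.one_lt_goldenRatio
  have hz : z < 0 := by
    by_contra hle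
    have := one_le_zpow₀ Real.one_lt_goldenRatio.le (not_lt.1 hle)
    linarith
  obtain ⟨k, rfl⟩ : ∃ k : ℕ, z = -(k : ℤ) := ⟨z.natAbs, by omega⟩
  have hk : 1 ≤ k := by omega
  set q : ℕ → ℝ := fun j => runBase x (runWord x k j) with hq
  set n : ℕ → ℕ := fun j => runIndex x (runWord x k j) with hn
  set B : ℕ → List Bool := fun j => block (q j) (n j) with hB
  have hblocks : ∀ j, blocks k B j = runWord x k j := blocks_runWord x k
  have hbaseOf : ∀ j, (∃ s, IsBaseOf x (prepend (blocks k B j) zeroOnes) s) →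
      IsBaseOf x (prepend (blocks k B j) zeroOnes) (q j) := fun j hs => by
    rw [hblocks] at hs ⊢
    exact Classical.epsilon_spec hs
  have hrun : ∀ J, IsPartialRun x k q n B J := by
    intro J
    induction J with
    | zero =>
      refine ⟨hk, hz1, hz2, fun j hj => ?_, fun j hj => by omega, fun _ _ => rfl⟩
      obtain rfl : j = 0 := by omega
      refine hbaseOf 0 ?_
      rw [blocks_zero]
      obtain ⟨h1, h2⟩ := goldenRatio_bounds hk hz1 hz2
      exact exists_initial h1 h2
    | succ J ih =>
      have hJ := ih.isLowerBase hx0 hx1 le_rfl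
      have hN : IsN (q J) (n J) := by
        refine Classical.epsilon_spec (p := IsN (q J)) ?_
        by_contra hno
        refine hV (ih.qs_mem_setV hx0 hx1 fun l => ?_)
        rw [← not_seqLE]
        exact fun hle => hno (exists_isN hle)
      refine ⟨hk, hz1, hz2, fun j hj => ?_, fun j hj => ?_, fun _ _ => rfl⟩
      · rcases Nat.lt_or_ge J j with hJj | hjJ
        · obtain rfl : j = J + 1 := by omega
          refine hbaseOf (J + 1) ?_
          have hBJ : B J = critBlock (alpha (q J)) (n J - 1) :=
            block_eq_critBlock (hN.two_le hJ.one_lt hJ.lt_two.le)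
          rw [blocks_succ, hBJ]
          exact hJ.exists_next (hN.isCritical hJ.one_lt hJ.lt_two.le)
        · exact ih.isBase_q j hjJ
      · rcases Nat.lt_or_ge j J with hjJ | hjJ
        · exact ih.isN j hjJ
        · obtain rfl : j = J := by omega
          exact hN
  have hupper : ∀ j, ∃ r, IsBaseOf x (prepend (blocks k B j) (periodic (B j))) r := fun j => by
    obtain ⟨hc, hBj⟩ := (hrun (j + 1)).block_eq_critBlock (Nat.lt_succ_self j)
    rw [hBj]
    exact ((hrun j).isLowerBase hx0 hx1 le_rfl).exists_upper hc
  choose r hr using hupper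
  refine ⟨k, q, n, B, r, hk, hz1, hz2, fun j => (hrun j).isBase_q j le_rfl, fun j hcl => ?_,
    fun j => (hrun (j + 1)).isN j (Nat.lt_succ_self j), fun _ => rfl, hr⟩
  have hj := (hrun j).isLowerBase hx0 hx1 le_rfl
  obtain ⟨hc, -⟩ := (hrun (j + 1)).block_eq_critBlock (Nat.lt_succ_self j)
  have hlt := conj_shift_alpha_lt_of_mem_closure hj.one_lt hj.lt_two hcl (n j - 1 - 1)
  rw [Nat.sub_add_cancel hc.pos] at hlt
  exact not_seqLT.2 hc.le hlt

end SmallestBase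

theorem proposition4p3 (x : ℝ) (hx0 : 0 < x) (hx1 : x < 1) :
    SmallestBase.IsTypeII x ↔ SmallestBase.qs x ∉ SmallestBase.setV := by
  constructor
  · rintro ⟨k, q, n, B, r, hrun, j, hfin⟩
    exact hrun.notMem_setV_of_finiteCondition hx0 hx1 hfin
  · intro hV
    obtain ⟨k, q, n, B, r, hrun⟩ := SmallestBase.exists_isInfiniteRun hx0 hx1 hV
    exact ⟨k, q, n, B, r, hrun, hrun.finiteCondition_of_notMem_setV hx0 hx1 hV⟩
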